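/- Let $d\ge 1$ and let $\operatorname{vol}_p$ denote $p$-dimensional Hausdorff measure on $\mathbb R^d$, normalised to agree with Lebesgue measure. For $x\ne 0$ let $P_x$ be the orthogonal projection of $\mathbb R^d$ onto $x^\perp$. For a convex body $K\subset\mathbb R^d$ (convex, compact, non-empty interior) with $0\in K$, a point $x\notin K$ and $z\in P_x(K)$, let $\pi_K(x,z)$ be the minimiser of $\langle y,x\rangle$ over $y\in K\cap\{z+tx:t\in\mathbb R\}$, and define $$\Psi_K(x,z)=\frac{\operatorname{vol}_1(K\cap[x,\pi_K(x,z)])}{\operatorname{vol}_1([x,\pi_K(x,z)])},\qquad \Psi_K(x)=\frac1{\operatorname{vol}_{d-1}(P_x(K))}\int_{P_x(K)}\Psi_K(x,z)\,d\operatorname{vol}_{d-1}(z).$$ **Lemma.** Let $\mathcal D\subset\mathbb R^d$ be a convex body, let $f,g:\mathcal D\to\mathbb R$ be convex with $f_\star\le g_\star$, where $f_\star=\inf_{\mathcal D}f$ and $g_\star=\inf_{\mathcal D}g$, let $\varepsilon>0$, and let $K=\{x\in\mathcal D: g(x)\le g_\star+\varepsilon\}$. Let $\rho=\operatorname{vol}_{d-1}|_{\partial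 K}/\operatorname{vol}_{d-1}(\partial K)$ be the uniform probability measure on $\partial K$. Assume that $K$ is closed and that $g$ and $(f-g)^2$ are $\rho$-integrable (all of this is automatic when $f$ and $g$ are continuous on $\mathcal D$). Let $x_\star\in\mathcal D$ be a minimiser of $f$, and assume that $0\in K$ and $\Psi_K(x_\star)\in\left[\frac1{128d},\frac1{32d}\right]$. Then $$\int_{\partial K} g\,d\rho-f_\star\le 2^{13}\,d\,\sqrt{\max_{\theta\in S^{d-1}}\left(\frac{\operatorname{vol}_{d-1}(\partial K)}{\operatorname{vol}_{d-1}(P_\theta(K))}\right)\int_{\partial K}(f-g)^2\,d\rho}\,.$$ -/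

import Mathlib

open MeasureTheory

namespace ConvexBandit

/-- A convex body in `ℝᵈ`: a convex compact set with non-empty interior. -/
structure IsConvexBody {d : ℕ} (D : Set (EuclideanSpace ℝ (Fin d))) : Prop where
  convex : Convex ℝ D
  isCompact : IsCompact D
  interior_nonempty : (interior D).Nonempty

/-- The infimum `f_⋆` of `f` over `D`. -/
noncomputable def infOn {d : ℕ} (D : Set (EuclideanSpace ℝ (Fin d)))
    (f : EuclideanSpace ℝ (Fin d) → ℝ) : ℝ :=
  sInf (f '' D)

/-- The level set `{x ∈ D : g x ≤ g_⋆ + ε}`. -/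
def levelSet {d : ℕ} (D : Set (EuclideanSpace ℝ (Fin d)))
    (g : EuclideanSpace ℝ (Fin d) → ℝ) (ε : ℝ) : Set (EuclideanSpace ℝ (Fin d)) :=
  {x | x ∈ D ∧ g x ≤ infOn D g + ε}

/-- The shadow `P_x(K)`: the image of `K` under the orthogonal projection onto the
hyperplane `x^⊥` (as a subset of the ambient space). -/
noncomputable def shadow {d : ℕ} (x : EuclideanSpace ℝ (Fin d))
    (K : Set (EuclideanSpace ℝ (Fin d))) : Set (EuclideanSpace ℝ (Fin d)) :=
  (fun y => (Submodule.span ℝ {x})ᗮ.starProjection y) '' K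

/-- `π_K(x, z)`: the minimiser of `y ↦ ⟪y, x⟫` over the part of `K` on the line
`{z + t x : t ∈ ℝ}`. For `K` compact, `x ≠ 0` and `z` in the shadow of `K` in direction `x`
it exists and is unique. -/
noncomputable def farPoint {d : ℕ} (K : Set (EuclideanSpace ℝ (Fin d)))
    (x z : EuclideanSpace ℝ (Fin d)) : EuclideanSpace ℝ (Fin d) :=
  Classical.epsilon fun y =>
    y ∈ K ∩ Set.range (fun t : ℝ => z + t • x) ∧
      IsMinOn (fun w => inner ℝ w x) (K ∩ Set.range (fun t : ℝ => z + t • x)) y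

/-- The depth/distance ratio `Ψ_K(x, z)`. -/
noncomputable def depthRatio {d : ℕ} (K : Set (EuclideanSpace ℝ (Fin d)))
    (x z : EuclideanSpace ℝ (Fin d)) : ℝ :=
  (μHE[1] : Measure (EuclideanSpace ℝ (Fin d))).real (K ∩ segment ℝ x (farPoint K x z)) /
    (μHE[1] : Measure (EuclideanSpace ℝ (Fin d))).real (segment ℝ x (farPoint K x z))

/-- The average depth/distance ratio `Ψ_K(x)`. -/
noncomputable def avgDepthRatio {d : ℕ} (K : Set (EuclideanSpace ℝ (Fin d)))
    (x : EuclideanSpace ℝ (Fin d)) : ℝ :=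
  ((μHE[d - 1] : Measure (EuclideanSpace ℝ (Fin d))).real (shadow x K))⁻¹ *
    ∫ z in shadow x K, depthRatio K x z ∂(μHE[d - 1] : Measure (EuclideanSpace ℝ (Fin d)))

/-- The surface area probability measure on `∂K`. -/
noncomputable def surfaceProb {d : ℕ} (K : Set (EuclideanSpace ℝ (Fin d))) :
    Measure (EuclideanSpace ℝ (Fin d)) :=
  ((μHE[d - 1] : Measure (EuclideanSpace ℝ (Fin d))) (frontier K))⁻¹ •
    (μHE[d - 1] : Measure (EuclideanSpace ℝ (Fin d))).restrict (frontier K)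

/-- `max_{θ ∈ S^{d-1}} vol_{d-1}(∂K) / vol_{d-1}(P_θ(K))`, written as a supremum. -/
noncomputable def maxSurfaceShadowRatio {d : ℕ} (K : Set (EuclideanSpace ℝ (Fin d))) : ℝ :=
  ⨆ θ : Metric.sphere (0 : EuclideanSpace ℝ (Fin d)) 1,
    (μHE[d - 1] : Measure (EuclideanSpace ℝ (Fin d))).real (frontier K) /
      (μHE[d - 1] : Measure (EuclideanSpace ℝ (Fin d))).real
        (shadow (θ : EuclideanSpace ℝ (Fin d)) K)

end ConvexBandit

/-! Write G = g_⋆ + ε, m = Ψ_K(x_⋆), N for the volume of the shadow of K in direction x_⋆, and S for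
the surface area of K. Since g ≤ G on ∂K, it is enough to bound Δ = G - f(x_⋆) when it is positive.
The bounds on m force x_⋆ ≠ 0 and x_⋆ ∉ K.

For z in the shadow, let p(z) be the far point of K over z, and let q(z) be the point where the
segment from p(z) to x_⋆ leaves K. The exit time s(z) is Ψ_K(x_⋆, z). Because g(p) ≤ G ≤ g(q),
convexity of f along the segment gives s(z) Δ ≤ |f - g|(q) + |f - g|(p) (`depth_mul_le`). This is
squared and integrated over the set A of those z with m/4 ≤ s(z) ≤ 1/(2d). Three facts make the
integration work.

A fills at least 1/16 of the shadow. The function 1/(1 - s) is concave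
(`concaveOn_inv_one_sub_depth`), so the midpoint of any y and a z with s(z) ≥ 2t has exit time at
least t. Brunn–Minkowski then gives vol{s ≥ 2t} · N ≤ vol{s ≥ t}², a tail bound which prevents the
mean m from being carried by a small set (`measureReal_comparable_mean_ge`). Markov's inequality
removes the large values.

The map p is a section of the orthogonal projection, which is 1-Lipschitz, so the volume of a piece
of A is at most the surface area of its image under p.

The map q projects to z ↦ (1 - s(z)) z. By the same concavity, this radial map loses at most a
factor (1 - 1/(2d))^{-d} ≤ 2 of volume on A (`measure_le_of_radial_contraction`).

Together these give (mΔ/4)² N/16 ≤ 6 S ∫(f - g)² dρ (`gap_sq_mul_le`), and m ≥ 1/(128d) turns this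
into the stated bound. -/

/-! ### Brunn–Minkowski and Prékopa–Leindler inequalities for midpoints -/

/-- One-dimensional Brunn–Minkowski inequality, with `C` containing all midpoints. -/
theorem volume_add_volume_le_of_midpoint_mem {A B C : Set ℝ} (hA : MeasurableSet A)
    (hB : MeasurableSet B) (hA₀ : A.Nonempty) (hB₀ : B.Nonempty)
    (h : ∀ a ∈ A, ∀ b ∈ B, (a + b) / 2 ∈ C) : volume A + volume B ≤ 2 * volume C := by
  have key : ∀ A' ⊆ A, ∀ B' ⊆ B, IsCompact A' → IsCompact B' → A'.Nonempty → B'.Nonempty →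
      volume A' + volume B' ≤ 2 * volume C := by
    intro A' hA' B' hB' cA cB nA nB
    obtain ⟨a, ha, hamax⟩ := cA.exists_isGreatest nA
    obtain ⟨b, hb, hbmin⟩ := cB.exists_isLeast nB
    -- `C₂` is the dilate 2C. It contains A' + b and a + B'; with a = max A' and b = min B' these
    -- translates lie on opposite sides of a + b.
    set C₂ : Set ℝ := (fun t => 2⁻¹ * t) ⁻¹' C with hC₂
    have hvol : volume C₂ = 2 * volume C := by
      rw [hC₂, Real.volume_preimage_mul_left (by norm_num)]
      norm_num
    have h1 : volume A' ≤ volume (C₂ ∩ Set.Iic (a + b)) := by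
      rw [← measure_preimage_add_right volume b (C₂ ∩ _)]
      refine measure_mono fun t ht => ⟨?_, ?_⟩
      · have := h t (hA' ht) b (hB' hb)
        simp only [hC₂, Set.mem_preimage]
        convert this using 1; ring
      · have := hamax ht
        simp only [Set.mem_Iic]; linarith
    have h2 : volume B' ≤ volume (C₂ ∩ Set.Ioi (a + b)) := by
      have hI : volume (C₂ ∩ Set.Ioi (a + b)) = volume (C₂ ∩ Set.Ici (a + b)) :=
        measure_congr ((Filter.EventuallyEq.refl _ _).inter Ioi_ae_eq_Ici)
      rw [hI, ← measure_preimage_add_right volume a (C₂ ∩ _)]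
      refine measure_mono fun t ht => ⟨?_, ?_⟩
      · have := h a (hA' ha) t (hB' ht)
        simp only [hC₂, Set.mem_preimage]
        convert this using 1; ring
      · have := hbmin ht
        simp only [Set.mem_Ici]; linarith
    calc volume A' + volume B'
        ≤ volume (C₂ ∩ Set.Iic (a + b)) + volume (C₂ ∩ Set.Ioi (a + b)) := add_le_add h1 h2
      _ = volume C₂ := by
          rw [← Set.compl_Iic, ← Set.sdiff_eq]
          exact measure_inter_add_sdiff _ measurableSet_Iic
      _ = _ := hvol
  have approx : ∀ S : Set ℝ, MeasurableSet S → ∀ r < volume S,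
      ∃ S' ⊆ S, IsCompact S' ∧ S'.Nonempty ∧ r < volume S' := by
    intro S hS r hr
    obtain ⟨S', h1, h2, h3⟩ := hS.exists_lt_isCompact hr
    exact ⟨S', h1, h2, nonempty_of_measure_ne_zero (ne_bot_of_gt h3), h3⟩
  have approx' : ∀ S : Set ℝ, MeasurableSet S → S.Nonempty →
      ∀ c T : ENNReal, (∀ S' ⊆ S, IsCompact S' → S'.Nonempty → c + volume S' ≤ T) →
        c + volume S ≤ T := by
    intro S hS hS₀ c T hT
    -- The approximating compact sets must be nonempty, so a null set is handled separately by a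
    -- single point.
    rcases eq_or_ne (volume S) 0 with h0 | h0
    · obtain ⟨s, hs⟩ := hS₀
      have := hT {s} (by simpa using hs) isCompact_singleton ⟨s, rfl⟩
      simpa [h0] using this
    · have hsup : volume S = ⨆ r : Set.Iio (volume S), (r : ENNReal) := by
        rw [← sSup_eq_iSup', (isLUB_Iio (a := volume S)).sSup_eq]
      have : Nonempty (Set.Iio (volume S)) := ⟨⟨0, pos_iff_ne_zero.mpr h0⟩⟩
      rw [hsup, ENNReal.add_iSup]
      refine iSup_le fun ⟨r, hr⟩ => ?_
      obtain ⟨S', h1, h2, h3, h4⟩ := approx S hS r hr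
      exact (add_le_add_right h4.le c).trans (hT S' h1 h2 h3)
  refine approx' B hB hB₀ _ _ fun B' hB' cB nB => ?_
  rw [add_comm]
  refine approx' A hA hA₀ _ _ fun A' hA' cA nA => ?_
  rw [add_comm]
  exact key A' hA' B' hB' cA cB nA nB

theorem lintegral_eq_lintegral_measure_ofReal_lt {α : Type*} [MeasurableSpace α] (μ : Measure α)
    {f : α → ENNReal} (hf : Measurable f) (hfin : ∀ a, f a ≠ ⊤) :
    ∫⁻ a, f a ∂μ = ∫⁻ t in Set.Ioi (0 : ℝ), μ {a | ENNReal.ofReal t < f a} := by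
  have := lintegral_eq_lintegral_meas_lt (f := fun a => (f a).toReal) μ
    (Filter.Eventually.of_forall fun a => ENNReal.toReal_nonneg) hf.ennreal_toReal.aemeasurable
  simp only [ENNReal.ofReal_toReal (hfin _)] at this
  rw [this]
  refine setLIntegral_congr_fun measurableSet_Ioi fun t ht => ?_
  congr 1
  ext a
  exact (ENNReal.ofReal_lt_iff_lt_toReal (le_of_lt ht) (hfin a)).symm

/-- The layer-cake formula reduces this to one-dimensional Brunn–Minkowski at each level. The two
supremum conditions make the superlevel sets nonempty at every level below 1, which Brunn–Minkowski
requires. -/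
theorem lintegral_add_lintegral_le_of_min_le {f g h : ℝ → ENNReal} (hf : Measurable f)
    (hg : Measurable g) (hh : Measurable h) (hf1 : ∀ x, f x ≤ 1) (hg1 : ∀ x, g x ≤ 1)
    (hfs : ∀ t < 1, ∃ x, t < f x) (hgs : ∀ t < 1, ∃ x, t < g x)
    (H : ∀ x y, min (f x) (g y) ≤ h ((x + y) / 2)) :
    (∫⁻ x, f x) + ∫⁻ x, g x ≤ 2 * ∫⁻ x, h x := by
  -- Levels above 1 contribute nothing to the left side, so h may be truncated at 1; this provides
  -- the finiteness needed for the layer-cake formula.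
  set k : ℝ → ENNReal := fun x => min (h x) 1
  have hk : Measurable k := hh.min measurable_const
  have hkh : ∫⁻ x, k x ≤ ∫⁻ x, h x := lintegral_mono fun x => min_le_left _ _
  refine le_trans ?_ (mul_le_mul_right hkh 2)
  have fin : ∀ {u : ℝ → ENNReal}, (∀ x, u x ≤ 1) → ∀ x, u x ≠ ⊤ := fun hu x =>
    ((hu x).trans_lt ENNReal.one_lt_top).ne
  rw [lintegral_eq_lintegral_measure_ofReal_lt _ hf (fin hf1),
    lintegral_eq_lintegral_measure_ofReal_lt _ hg (fin hg1),
    lintegral_eq_lintegral_measure_ofReal_lt _ hk (fin fun x => min_le_right _ _),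
    ← lintegral_const_mul' _ _ (by norm_num)]
  have anti : ∀ u : ℝ → ENNReal, Antitone fun t : ℝ => volume {a | ENNReal.ofReal t < u a} :=
    fun u s t hst => measure_mono fun a ha => (ENNReal.ofReal_le_ofReal hst).trans_lt ha
  rw [← lintegral_add_left (anti f).measurable]
  refine lintegral_mono fun t => ?_
  rcases lt_or_ge (ENNReal.ofReal t) 1 with ht | ht
  · refine volume_add_volume_le_of_midpoint_mem (measurableSet_lt measurable_const hf)
      (measurableSet_lt measurable_const hg) (hfs _ ht) (hgs _ ht) fun a ha b hb => ?_
    exact lt_min ((lt_min ha hb).trans_le (H a b)) ht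
  · have e : ∀ u : ℝ → ENNReal, (∀ x, u x ≤ 1) → {a | ENNReal.ofReal t < u a} = ∅ := fun u hu =>
      Set.eq_empty_of_forall_notMem fun a ha => absurd (ha.trans_le (hu a)) (not_lt.mpr ht)
    simp [e f hf1, e g hg1]

theorem ENNReal.mul_le_sq_of_add_le_two_mul {a b c : ENNReal} (h : a + b ≤ 2 * c) :
    a * b ≤ c ^ 2 := by
  rcases eq_or_ne c ⊤ with rfl | hc
  · simp
  have hab : a + b ≠ ⊤ := (h.trans_lt (ENNReal.mul_lt_top (by norm_num) hc.lt_top)).ne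
  obtain ⟨ha, hb⟩ := ENNReal.add_ne_top.mp hab
  lift a to NNReal using ha
  lift b to NNReal using hb
  lift c to NNReal using hc
  norm_cast at h ⊢
  have : (a : ℝ) + b ≤ 2 * c := by exact_mod_cast h
  have : (a : ℝ) * b ≤ c ^ 2 := by
    nlinarith [sq_nonneg ((a : ℝ) - b), a.coe_nonneg, b.coe_nonneg, c.coe_nonneg]
  exact_mod_cast this

/-- Dividing f and g by their suprema a and b, and h by √(ab), gives the additive inequality,
because a minimum is at most a geometric mean. AM–GM then returns to the product form. -/
theorem lintegral_mul_lintegral_le_sq_of_le_const {f g h : ℝ → ENNReal} (hf : Measurable f)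
    (hg : Measurable g) (hh : Measurable h) {M : ENNReal} (hM : M ≠ ⊤) (hfM : ∀ x, f x ≤ M)
    (hgM : ∀ x, g x ≤ M) (H : ∀ x y, f x * g y ≤ h ((x + y) / 2) ^ 2) :
    (∫⁻ x, f x) * ∫⁻ x, g x ≤ (∫⁻ x, h x) ^ 2 := by
  set a := ⨆ x, f x with ha
  set b := ⨆ x, g x with hb
  have haM : a ≠ ⊤ := ((iSup_le hfM).trans_lt hM.lt_top).ne
  have hbM : b ≠ ⊤ := ((iSup_le hgM).trans_lt hM.lt_top).ne
  rcases eq_or_ne a 0 with ha0 | ha0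
  · have : ∀ x, f x = 0 := by simpa [ha] using ha0
    simp [this]
  rcases eq_or_ne b 0 with hb0 | hb0
  · have : ∀ x, g x = 0 := by simpa [hb] using hb0
    simp [this]
  obtain ⟨c, hc⟩ : ∃ c : ENNReal, c ^ 2 = a * b := by
    refine ⟨(a * b) ^ (1 / 2 : ℝ), ?_⟩
    rw [← ENNReal.rpow_natCast, ← ENNReal.rpow_mul]
    norm_num
  have norm : ∀ (u : ℝ → ENNReal) (s : ENNReal), s = ⨆ x, u x → s ≠ 0 → s ≠ ⊤ →
      (∀ x, s⁻¹ * u x ≤ 1) ∧ ∀ t < 1, ∃ x, t < s⁻¹ * u x := by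
    intro u s hs h0 h1
    refine ⟨fun x => ?_, fun t ht => ?_⟩
    · rw [mul_comm, ← div_eq_mul_inv]
      exact ENNReal.div_le_of_le_mul (by rw [one_mul, hs]; exact le_iSup u x)
    · have : t * s < s := by
        conv_rhs => rw [← one_mul s]
        exact ENNReal.mul_lt_mul_left h0 h1 ht
      obtain ⟨x, hx⟩ := lt_iSup_iff.mp (this.trans_eq hs)
      refine ⟨x, ?_⟩
      rw [mul_comm, ← div_eq_mul_inv]
      exact (ENNReal.lt_div_iff_mul_lt (Or.inl h0) (Or.inl h1)).mpr hx
  obtain ⟨hf1, hfs⟩ := norm f a ha ha0 haM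
  obtain ⟨hg1, hgs⟩ := norm g b hb hb0 hbM
  have main := lintegral_add_lintegral_le_of_min_le (hf.const_mul a⁻¹) (hg.const_mul b⁻¹)
    (hh.const_mul c⁻¹) hf1 hg1 hfs hgs (fun x y => by
      rw [← (ENNReal.pow_right_strictMono two_ne_zero).le_iff_le, mul_pow,
        ← ENNReal.inv_pow, hc, ENNReal.mul_inv (Or.inl ha0) (Or.inl haM), sq]
      calc _ ≤ (a⁻¹ * f x) * (b⁻¹ * g y) :=
            mul_le_mul' (min_le_left _ _) (min_le_right _ _)
        _ = a⁻¹ * b⁻¹ * (f x * g y) := by ring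
        _ ≤ _ := mul_le_mul_right (H x y) _)
  rw [lintegral_const_mul _ hf, lintegral_const_mul _ hg, lintegral_const_mul _ hh] at main
  have := ENNReal.mul_le_sq_of_add_le_two_mul main
  rw [mul_pow, ← ENNReal.inv_pow, hc, ENNReal.mul_inv (Or.inl ha0) (Or.inl haM)] at this
  calc _ = (a * b) * ((a⁻¹ * ∫⁻ x, f x) * (b⁻¹ * ∫⁻ x, g x)) := by
        rw [show (a * b) * ((a⁻¹ * ∫⁻ x, f x) * (b⁻¹ * ∫⁻ x, g x)) =
          (a * a⁻¹) * (b * b⁻¹) * ((∫⁻ x, f x) * ∫⁻ x, g x) by ring,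
          ENNReal.mul_inv_cancel ha0 haM, ENNReal.mul_inv_cancel hb0 hbM]
        simp
    _ ≤ (a * b) * (a⁻¹ * b⁻¹ * (∫⁻ x, h x) ^ 2) := mul_le_mul_right this _
    _ = (a * a⁻¹) * (b * b⁻¹) * (∫⁻ x, h x) ^ 2 := by ring
    _ = _ := by
        rw [ENNReal.mul_inv_cancel ha0 haM, ENNReal.mul_inv_cancel hb0 hbM]
        simp

theorem lintegral_eq_iSup_lintegral_min {α : Type*} [MeasurableSpace α] (μ : Measure α)
    {f : α → ENNReal} (hf : Measurable f) :
    ∫⁻ a, f a ∂μ = ⨆ n : ℕ, ∫⁻ a, min (f a) n ∂μ := by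
  rw [← lintegral_iSup (fun n => hf.min measurable_const)
    (fun m n hmn a => min_le_min le_rfl (by exact_mod_cast hmn))]
  refine lintegral_congr fun a => ?_
  rw [← inf_iSup_eq, ENNReal.iSup_natCast, inf_top_eq]

/-- One-dimensional Prékopa–Leindler inequality for midpoints. -/
theorem lintegral_mul_lintegral_le_sq_real {f g h : ℝ → ENNReal} (hf : Measurable f)
    (hg : Measurable g) (hh : Measurable h) (H : ∀ x y, f x * g y ≤ h ((x + y) / 2) ^ 2) :
    (∫⁻ x, f x) * ∫⁻ x, g x ≤ (∫⁻ x, h x) ^ 2 := by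
  rw [lintegral_eq_iSup_lintegral_min _ hf, lintegral_eq_iSup_lintegral_min _ hg,
    ENNReal.iSup_mul]
  refine iSup_le fun m => ?_
  rw [ENNReal.mul_iSup]
  refine iSup_le fun n => ?_
  refine lintegral_mul_lintegral_le_sq_of_le_const (hf.min measurable_const)
    (hg.min measurable_const) hh (M := max m n) (by simp) (fun x => ?_) (fun x => ?_) fun x y =>
      (mul_le_mul' (min_le_left _ _) (min_le_left _ _)).trans (H x y)
  · exact (min_le_right _ _).trans (le_max_left _ _)
  · exact (min_le_right _ _).trans (le_max_right _ _)

/-- Prékopa–Leindler inequality for midpoints. -/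
theorem lintegral_mul_lintegral_le_sq {n : ℕ} {f g h : (Fin n → ℝ) → ENNReal} (hf : Measurable f)
    (hg : Measurable g) (hh : Measurable h)
    (H : ∀ x y, f x * g y ≤ h ((2⁻¹ : ℝ) • (x + y)) ^ 2) :
    (∫⁻ x, f x) * ∫⁻ x, g x ≤ (∫⁻ x, h x) ^ 2 := by
  induction n with
  | zero =>
    have : ∀ u : (Fin 0 → ℝ) → ENNReal, ∫⁻ x, u x = u 0 := fun u => by
      rw [lintegral_unique, volume_pi, Measure.pi_of_empty _ default]
      simp only [Measure.dirac_apply_of_mem (Set.mem_univ _), mul_one]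
      exact congrArg u (Subsingleton.elim _ _)
    rw [this, this, this]
    simpa using H 0 0
  | succ n ih =>
    let e := (MeasurableEquiv.piFinSuccAbove (fun _ : Fin (n + 1) => ℝ) 0).symm
    have he : MeasurePreserving e volume volume :=
      (volume_preserving_piFinSuccAbove (fun _ : Fin (n + 1) => ℝ) 0).symm _
    have hadd : ∀ s t x y, e ((s + t) / 2, (2⁻¹ : ℝ) • (x + y)) = (2⁻¹ : ℝ) • (e (s, x) + e (t, y)) := by
      intro s t x y
      ext i
      refine Fin.cases ?_ (fun j => ?_) i
      · simp [e, MeasurableEquiv.piFinSuccAbove, Fin.insertNthEquiv]; ring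
      · simp [e, MeasurableEquiv.piFinSuccAbove, Fin.insertNthEquiv]; ring
    have split : ∀ u : (Fin (n + 1) → ℝ) → ENNReal, Measurable u →
        ∫⁻ x, u x = ∫⁻ s : ℝ, ∫⁻ x : Fin n → ℝ, u (e (s, x)) := by
      intro u hu
      rw [← he.lintegral_comp hu, Measure.volume_eq_prod,
        lintegral_prod (fun p => u (e p)) (hu.comp e.measurable).aemeasurable]
    have meas : ∀ u : (Fin (n + 1) → ℝ) → ENNReal, Measurable u →
        Measurable fun s : ℝ => ∫⁻ x : Fin n → ℝ, u (e (s, x)) := fun u hu =>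
      (hu.comp e.measurable).lintegral_prod_right'
    rw [split f hf, split g hg, split h hh]
    refine lintegral_mul_lintegral_le_sq_real (meas f hf) (meas g hg) (meas h hh) fun s t => ?_
    have sec : ∀ (u : (Fin (n + 1) → ℝ) → ENNReal), Measurable u → ∀ s : ℝ,
        Measurable fun x : Fin n → ℝ => u (e (s, x)) := fun u hu s =>
      hu.comp (e.measurable.comp measurable_prodMk_left)
    refine ih (sec f hf s) (sec g hg t) (sec h hh _) fun x y => ?_
    rw [hadd]
    exact H _ _

/-- Multiplicative Brunn–Minkowski inequality for midpoints. -/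
theorem volume_mul_volume_le_sq_of_midpoint_mem {n : ℕ} {A B C : Set (EuclideanSpace ℝ (Fin n))}
    (hA : MeasurableSet A) (hB : MeasurableSet B) (hC : MeasurableSet C)
    (h : ∀ a ∈ A, ∀ b ∈ B, (2⁻¹ : ℝ) • (a + b) ∈ C) :
    volume A * volume B ≤ volume C ^ 2 := by
  have mp := (PiLp.volume_preserving_toLp (Fin n))
  have meas : ∀ S : Set (EuclideanSpace ℝ (Fin n)), MeasurableSet S →
      volume S = ∫⁻ x : Fin n → ℝ, S.indicator 1 (WithLp.toLp 2 x) := by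
    intro S hS
    rw [mp.lintegral_comp (measurable_one.indicator hS), lintegral_indicator_one hS]
  have sm : ∀ S : Set (EuclideanSpace ℝ (Fin n)), MeasurableSet S →
      Measurable fun x : Fin n → ℝ => (S.indicator 1 (WithLp.toLp 2 x) : ENNReal) := fun S hS =>
    (measurable_one.indicator hS).comp mp.measurable
  rw [meas A hA, meas B hB, meas C hC]
  refine lintegral_mul_lintegral_le_sq (sm A hA) (sm B hB) (sm C hC) fun x y => ?_
  by_cases hx : WithLp.toLp 2 x ∈ A
  · by_cases hy : WithLp.toLp 2 y ∈ B
    · have : WithLp.toLp 2 ((2⁻¹ : ℝ) • (x + y)) ∈ C := h _ hx _ hy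
      rw [Set.indicator_of_mem this]
      simp [hx, hy]
    · simp [hy]
  · simp [hx]

/-! ### Volume distortion of radial maps -/

/-- An expanding map is injective and its inverse is 1-Lipschitz, so the inverse cannot increase
one-dimensional Hausdorff measure. Neither S nor T need be measurable. -/
theorem volume_le_volume_of_expanding {S T : Set ℝ} {m : ℝ → ℝ} (hST : Set.MapsTo m S T)
    (hm : ∀ a ∈ S, ∀ b ∈ S, a ≤ b → b - a ≤ m b - m a) : volume S ≤ volume T := by
  have hdist : ∀ a ∈ S, ∀ b ∈ S, |a - b| ≤ |m a - m b| := by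
    intro a ha b hb
    rcases le_total a b with h | h
    · rw [abs_sub_comm, abs_sub_comm (m a), abs_of_nonneg (sub_nonneg.mpr h)]
      exact (hm a ha b hb h).trans (le_abs_self _)
    · rw [abs_of_nonneg (sub_nonneg.mpr h)]
      exact (hm b hb a ha h).trans (le_abs_self _)
  have hinj : Set.InjOn m S := by
    intro a ha b hb hab
    have := hdist a ha b hb
    rw [hab, sub_self, abs_zero] at this
    exact sub_eq_zero.mp (abs_nonpos_iff.mp this)
  have hleft : ∀ a ∈ S, Function.invFunOn m S (m a) = a := fun a ha => hinj.leftInvOn_invFunOn ha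
  have hlip : LipschitzOnWith 1 (Function.invFunOn m S) (m '' S) := by
    refine LipschitzOnWith.of_dist_le_mul ?_
    rintro _ ⟨a, ha, rfl⟩ _ ⟨b, hb, rfl⟩
    rw [hleft a ha, hleft b hb]
    simpa [Real.dist_eq] using hdist a ha b hb
  have himg : Function.invFunOn m S '' (m '' S) = S := by
    rw [Set.image_image]
    ext a
    constructor
    · rintro ⟨b, hb, rfl⟩
      simpa [hleft b hb] using hb
    · exact fun ha => ⟨a, ha, hleft a ha⟩
  have := hlip.hausdorffMeasure_image_le (d := 1) zero_le_one
  rw [himg, hausdorffMeasure_real] at this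
  simpa using this.trans (by simpa using measure_mono hST.image_subset)

section Radial

variable {W : Type*} [NormedAddCommGroup W] [NormedSpace ℝ W] [FiniteDimensional ℝ W]
  [MeasurableSpace W] [BorelSpace W] (μ : Measure W) [μ.IsAddHaarMeasure]

theorem measurableSet_cone {X : Set W} (hX : MeasurableSet X) (M : ℝ) :
    MeasurableSet {p : ℝ × W | p.1 ∈ Set.Ioc 0 M ∧ p.1⁻¹ • p.2 ∈ X} :=
  (measurable_fst measurableSet_Ioc).inter ((measurable_fst.inv.smul measurable_snd) hX)

/-- The slice at height l is l·X. Cones turn a comparison of two sets in W into a comparison of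
one-dimensional fibres over w, which avoids any Jacobian. -/
theorem prod_measure_cone {X : Set W} (hX : MeasurableSet X) {M : ℝ} (hM : 0 ≤ M) :
    ((volume : Measure ℝ).prod μ) {p : ℝ × W | p.1 ∈ Set.Ioc 0 M ∧ p.1⁻¹ • p.2 ∈ X} =
      ENNReal.ofReal (M ^ (Module.finrank ℝ W + 1) / (Module.finrank ℝ W + 1)) * μ X := by
  rw [Measure.prod_apply (measurableSet_cone hX M)]
  have h1 : ∀ l : ℝ, μ (Prod.mk l ⁻¹' {p : ℝ × W | p.1 ∈ Set.Ioc 0 M ∧ p.1⁻¹ • p.2 ∈ X}) =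
      (Set.Ioc 0 M).indicator (fun l => ENNReal.ofReal (l ^ Module.finrank ℝ W) * μ X) l := by
    intro l
    by_cases hl : l ∈ Set.Ioc 0 M
    · rw [Set.indicator_of_mem hl]
      have : Prod.mk l ⁻¹' {p : ℝ × W | p.1 ∈ Set.Ioc 0 M ∧ p.1⁻¹ • p.2 ∈ X} =
          (fun w => l⁻¹ • w) ⁻¹' X := by
        ext w
        simp only [Set.mem_preimage, Set.mem_ofPred_eq, hl, true_and]
      rw [this, Measure.addHaar_preimage_smul _ (inv_ne_zero hl.1.ne'), inv_pow, inv_inv,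
        abs_of_nonneg (pow_nonneg hl.1.le _)]
    · rw [Set.indicator_of_notMem hl]
      have : Prod.mk l ⁻¹' {p : ℝ × W | p.1 ∈ Set.Ioc 0 M ∧ p.1⁻¹ • p.2 ∈ X} = ∅ := by
        ext w
        simp only [Set.mem_preimage, Set.mem_ofPred_eq, hl, false_and, Set.mem_empty_iff_false]
      rw [this, measure_empty]
  simp only [h1]
  rw [lintegral_indicator measurableSet_Ioc, lintegral_mul_const _ (by fun_prop)]
  congr 1
  rw [← ofReal_integral_eq_lintegral_ofReal]
  · congr 1
    rw [← intervalIntegral.integral_of_le hM, integral_pow]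
    simp
  · rw [← IntegrableOn, ← intervalIntegrable_iff_integrableOn_Ioc_of_le hM]
    exact (continuous_pow _).intervalIntegrable _ _
  · exact (ae_restrict_iff' measurableSet_Ioc).mpr
      (Filter.Eventually.of_forall fun l hl => pow_nonneg hl.1.le _)

/-- If `Φ` is concave with `1 ≤ Φ 0`, the radial map `z ↦ z / Φ z` shrinks volumes on `{Φ ≤ L}` by
a factor at most `L ^ (n + 1)`. -/
theorem measure_le_of_radial_contraction {Z A B : Set W} {Φ : W → ℝ} {L : ℝ}
    (hΦ : ConcaveOn ℝ Z Φ) (h0 : 0 ∈ Z) (h1 : 1 ≤ Φ 0) (hA : MeasurableSet A) (hAZ : A ⊆ Z)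
    (hB : MeasurableSet B) (hpos : ∀ z ∈ A, 0 < Φ z) (hL : ∀ z ∈ A, Φ z ≤ L)
    (hAB : ∀ z ∈ A, (Φ z)⁻¹ • z ∈ B) :
    μ A ≤ ENNReal.ofReal (L ^ (Module.finrank ℝ W + 1)) * μ B := by
  rcases A.eq_empty_or_nonempty with rfl | ⟨a₀, ha₀⟩
  · simp
  have hL0 : 0 < L := (hpos a₀ ha₀).trans_le (hL a₀ ha₀)
  set n := Module.finrank ℝ W
  have key : ENNReal.ofReal ((1 : ℝ) ^ (n + 1) / (n + 1)) * μ A ≤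
      ENNReal.ofReal (L ^ (n + 1) / (n + 1)) * μ B := by
    rw [← prod_measure_cone μ hA zero_le_one, ← prod_measure_cone μ hB hL0.le,
      Measure.prod_apply_symm (measurableSet_cone hA 1),
      Measure.prod_apply_symm (measurableSet_cone hB L)]
    refine lintegral_mono fun w => ?_
    -- The perspective l ↦ l Φ(w/l) sends the fibre of the cone over A into the fibre of the cone
    -- over B.
    refine volume_le_volume_of_expanding (m := fun l => l * Φ (l⁻¹ • w)) ?_ ?_
    · rintro l ⟨⟨hl0, hl1⟩, hlA⟩
      have hp := hpos _ hlA
      refine ⟨⟨mul_pos hl0 hp, ?_⟩, ?_⟩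
      · calc l * Φ (l⁻¹ • w) ≤ 1 * L := mul_le_mul hl1 (hL _ hlA) hp.le zero_le_one
          _ = L := one_mul L
      · have := hAB _ hlA
        rw [smul_smul] at this
        simpa [mul_inv, mul_comm] using this
    · rintro s ⟨⟨hs0, hs1⟩, hsA⟩ t ⟨⟨ht0, ht1⟩, htA⟩ hst
      simp only at hsA htA hs0 ht0
      -- For s ≤ t the point w/t is a convex combination of w/s and 0. Concavity and Φ 0 ≥ 1 then
      -- make the perspective grow with slope at least 1.
      have hc := hΦ.2 (hAZ hsA) h0 (show 0 ≤ s / t by positivity)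
        (sub_nonneg.mpr ((div_le_one ht0).mpr hst)) (by ring)
      have e : (s / t) • s⁻¹ • w + (1 - s / t) • (0 : W) = t⁻¹ • w := by
        rw [smul_zero, add_zero, smul_smul]
        congr 1
        field_simp
      rw [e] at hc
      simp only [smul_eq_mul] at hc
      have h2 := mul_le_mul_of_nonneg_left hc ht0.le
      have e2 : t * (s / t * Φ (s⁻¹ • w) + (1 - s / t) * Φ 0) =
          s * Φ (s⁻¹ • w) + (t - s) * Φ 0 := by
        field_simp
      rw [e2] at h2
      nlinarith [mul_le_mul_of_nonneg_left h1 (sub_nonneg.mpr hst)]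
  have hn : (0 : ℝ) < n + 1 := by positivity
  rw [one_pow, div_eq_mul_inv (L ^ (n + 1)), ENNReal.ofReal_mul (by positivity), one_div,
    mul_comm (ENNReal.ofReal (L ^ (n + 1))), mul_assoc] at key
  exact (ENNReal.mul_le_mul_iff_right (by simpa using hn) ENNReal.ofReal_ne_top).mp key

end Radial

/-! ### Functions with a log-concave type tail -/

section Tail

variable {α : Type*} [MeasurableSpace α] {ν : Measure α} [IsFiniteMeasure ν] {ψ : α → ℝ}

theorem integrable_of_mem_unitInterval (hψ : Measurable ψ) (h01 : ∀ a, ψ a ∈ Set.Icc (0 : ℝ) 1) :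
    Integrable ψ ν :=
  Integrable.of_bound hψ.aestronglyMeasurable 1
    (Filter.Eventually.of_forall fun a => by
      rw [Real.norm_eq_abs, abs_of_nonneg (h01 a).1]; exact (h01 a).2)

/-- Once the tail at t is at most 1/8 of the total mass, each doubling of the level shrinks it by a
further factor of 8, so the dyadic contributions to the integral decay geometrically. The induction
stops when 2^k t exceeds 1, the bound on ψ. -/
theorem setIntegral_superlevel_le (hψ : Measurable ψ) (h01 : ∀ a, ψ a ∈ Set.Icc (0 : ℝ) 1)
    (hlog : ∀ t > 0, ν.real {a | 2 * t ≤ ψ a} * ν.real Set.univ ≤ ν.real {a | t ≤ ψ a} ^ 2)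
    (hν : 0 < ν.real Set.univ) (k : ℕ) :
    ∀ t > 0, 1 < 2 ^ k * t → ν.real {a | t ≤ ψ a} ≤ ν.real Set.univ / 8 →
      ∫ a in {a | t ≤ ψ a}, ψ a ∂ν ≤ 4 * t * ν.real {a | t ≤ ψ a} := by
  have hm : ∀ t : ℝ, MeasurableSet {a | t ≤ ψ a} := fun t => measurableSet_le measurable_const hψ
  have hi := integrable_of_mem_unitInterval (ν := ν) hψ h01
  induction k with
  | zero =>
    intro t ht h1 _
    have : {a | t ≤ ψ a} = ∅ := Set.eq_empty_of_forall_notMem fun a ha => by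
      have := (h01 a).2
      have : t ≤ ψ a := ha
      linarith
    simp [this]
  | succ k ih =>
    intro t ht h1 h8
    set p := ν.real {a | t ≤ ψ a}
    set r := ν.real {a | 2 * t ≤ ψ a}
    set N := ν.real Set.univ
    have hp : 0 ≤ p := measureReal_nonneg
    have hr : r ≤ p / 8 := by
      have := hlog t ht
      have h3 : r * N ≤ (p / 8) * N := by nlinarith
      exact le_of_mul_le_mul_right h3 hν
    have h2 := ih (2 * t) (by positivity) (by rw [pow_succ] at h1; linarith) (by linarith)
    have hsplit : ∫ a in {a | t ≤ ψ a}, ψ a ∂ν ≤ 2 * t * p + ∫ a in {a | 2 * t ≤ ψ a}, ψ a ∂ν := by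
      rw [← integral_indicator (hm t), ← integral_indicator (hm (2 * t))]
      have : 2 * t * p = ∫ a, {a | t ≤ ψ a}.indicator (fun _ => 2 * t) a ∂ν := by
        rw [integral_indicator (hm t), setIntegral_const, smul_eq_mul, mul_comm]
      rw [this, ← integral_add ((integrable_const _).indicator (hm t)) (hi.indicator (hm _))]
      refine integral_mono (hi.indicator (hm t))
        (((integrable_const _).indicator (hm t)).add (hi.indicator (hm _))) fun a => ?_
      by_cases h1 : t ≤ ψ a <;> by_cases h2 : 2 * t ≤ ψ a <;>
        simp only [Set.indicator, Set.mem_ofPred_eq, h1, h2, if_true, if_false] <;> linarith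
    nlinarith

/-- A `[0, 1]`-valued function whose tail satisfies a log-concavity bound takes values comparable
to its mean on a set of non-negligible measure. -/
theorem measureReal_comparable_mean_ge (hψ : Measurable ψ)
    (h01 : ∀ a, ψ a ∈ Set.Icc (0 : ℝ) 1)
    (hlog : ∀ t > 0, ν.real {a | 2 * t ≤ ψ a} * ν.real Set.univ ≤ ν.real {a | t ≤ ψ a} ^ 2)
    (hν : 0 < ν.real Set.univ) {m : ℝ} (hm0 : 0 < m) (hm : ∫ a, ψ a ∂ν = m * ν.real Set.univ)
    {c : ℝ} (hc : 16 * m ≤ c) :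
    ν.real Set.univ / 16 ≤ ν.real {a | m / 4 ≤ ψ a ∧ ψ a ≤ c} := by
  have hms : ∀ t : ℝ, MeasurableSet {a | t ≤ ψ a} := fun t => measurableSet_le measurable_const hψ
  have hi := integrable_of_mem_unitInterval (ν := ν) hψ h01
  set N := ν.real Set.univ
  -- Otherwise the part of the integral above m/4 is at most mN/8 and the part below at most mN/4,
  -- too little for a total of mN.
  have hlow : N / 8 < ν.real {a | m / 4 ≤ ψ a} := by
    by_contra! hcon
    obtain ⟨k, hk⟩ := pow_unbounded_of_one_lt (4 / m) (one_lt_two (α := ℝ))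
    have hF := setIntegral_superlevel_le hψ h01 hlog hν k (m / 4) (by positivity)
      (by rw [div_lt_iff₀ hm0] at hk; linarith) hcon
    have hle : ∫ a, ψ a ∂ν ≤ m / 4 * N + ∫ a in {a | m / 4 ≤ ψ a}, ψ a ∂ν := by
      have : m / 4 * N = ∫ _, m / 4 ∂ν := by rw [integral_const, smul_eq_mul, mul_comm]
      rw [this, ← integral_indicator (hms _),
        ← integral_add (integrable_const _) (hi.indicator (hms _))]
      refine integral_mono hi ((integrable_const _).add (hi.indicator (hms _))) fun a => ?_
      by_cases h1 : m / 4 ≤ ψ a <;>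
        simp only [Set.indicator, Set.mem_ofPred_eq, h1, if_true, if_false] <;> linarith
    rw [hm] at hle
    have : 4 * (m / 4) * ν.real {a | m / 4 ≤ ψ a} ≤ m * (N / 8) := by
      rw [show 4 * (m / 4) = m by ring]
      exact mul_le_mul_of_nonneg_left hcon hm0.le
    nlinarith [mul_pos hm0 hν]
  -- Markov's inequality with c ≥ 16m.
  have hhigh : ν.real {a | c ≤ ψ a} ≤ N / 16 := by
    have := mul_meas_ge_le_integral_of_nonneg (μ := ν)
      (Filter.Eventually.of_forall fun a => (h01 a).1) hi c
    rw [hm] at this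
    have h2 : 16 * m * ν.real {a | c ≤ ψ a} ≤ m * N :=
      (mul_le_mul_of_nonneg_right hc measureReal_nonneg).trans this
    nlinarith
  have hunion : ν.real {a | m / 4 ≤ ψ a} ≤
      ν.real {a | m / 4 ≤ ψ a ∧ ψ a ≤ c} + ν.real {a | c ≤ ψ a} := by
    refine (measureReal_mono ?_).trans (measureReal_union_le _ _)
    intro a ha
    rcases le_total (ψ a) c with h | h
    · exact Or.inl ⟨ha, h⟩
    · exact Or.inr h
  linarith

end Tail

namespace ConvexBandit

/-! ### The lower boundary of a compact set in W × ℝ -/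

section Height

variable {W : Type*} [NormedAddCommGroup W]

/-- The lowest height of a point of `C` above `z`. -/
noncomputable def lowerHeight (C : Set (W × ℝ)) (z : W) : ℝ := sInf {t | (z, t) ∈ C}

variable {C : Set (W × ℝ)} {z : W}

theorem lowerHeight_isLeast (hC : IsCompact C) (hz : z ∈ Prod.fst '' C) :
    IsLeast {t | (z, t) ∈ C} (lowerHeight C z) := by
  obtain ⟨⟨z', t⟩, ht, rfl⟩ := hz
  have hcl : IsClosed {t | (z', t) ∈ C} := hC.isClosed.preimage (by fun_prop)
  have hbd : BddBelow {t | (z', t) ∈ C} := by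
    obtain ⟨m, hm⟩ := (hC.image continuous_snd).bddBelow
    exact ⟨m, fun s hs => hm ⟨_, hs, rfl⟩⟩
  exact ⟨hcl.csInf_mem ⟨t, ht⟩ hbd, fun s hs => csInf_le hbd hs⟩

theorem measurable_lowerHeight [MeasurableSpace W] [BorelSpace W] (hC : IsCompact C) :
    Measurable (lowerHeight C) := by
  refine measurable_of_Iic fun c => ?_
  have hZ : MeasurableSet (Prod.fst '' C) := (hC.image continuous_fst).isClosed.measurableSet
  have hS : MeasurableSet (Prod.fst '' (C ∩ {p : W × ℝ | p.2 ≤ c})) :=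
    ((hC.inter_right (isClosed_le continuous_snd continuous_const)).image
      continuous_fst).isClosed.measurableSet
  have : lowerHeight C ⁻¹' Set.Iic c =
      -- Off the projection of C the infimum of the empty set is 0, which accounts for the second
      -- piece.
      Prod.fst '' (C ∩ {p : W × ℝ | p.2 ≤ c}) ∪ ((Prod.fst '' C)ᶜ ∩ {_z | 0 ≤ c}) := by
    ext z
    by_cases hz : z ∈ Prod.fst '' C
    · have hl := lowerHeight_isLeast hC hz
      constructor
      · exact fun h => Or.inl ⟨(z, lowerHeight C z), ⟨hl.1, h⟩, rfl⟩
      · rintro (⟨⟨z, t⟩, ⟨h1, h2⟩, rfl⟩ | ⟨h, _⟩)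
        · exact (hl.2 h1).trans h2
        · exact absurd hz h
    · have h0 : lowerHeight C z = 0 := by
        have : {t | (z, t) ∈ C} = ∅ :=
          Set.eq_empty_of_forall_notMem fun t ht => hz ⟨_, ht, rfl⟩
        rw [lowerHeight, this, Real.sInf_empty]
      constructor
      · intro h
        refine Or.inr ⟨hz, ?_⟩
        simpa [h0] using h
      · rintro (⟨p, ⟨h1, _⟩, rfl⟩ | ⟨_, h⟩)
        · exact absurd ⟨p, h1, rfl⟩ hz
        · simpa [h0] using h
  rw [this]
  exact hS.union (hZ.compl.inter (MeasurableSet.const _))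

theorem notMem_interior_of_path {X : Type*} [TopologicalSpace X] {S : Set X} {γ : ℝ → X}
    (hγ : Continuous γ) {δ : ℝ} (hδ : 0 < δ) (h : ∀ t ∈ Set.Ioo 0 δ, γ t ∉ S) :
    γ 0 ∉ interior S := by
  intro h0
  have hev : ∀ᶠ t in nhdsWithin 0 (Set.Ioi 0), γ t ∈ interior S :=
    (hγ.tendsto 0).mono_left nhdsWithin_le_nhds (isOpen_interior.mem_nhds h0)
  obtain ⟨t, ht1, ht2⟩ := (hev.and (Ioo_mem_nhdsGT hδ)).exists
  exact h t ht2 (interior_subset ht1)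

theorem lowerHeight_mem_frontier (hC : IsCompact C) (hz : z ∈ Prod.fst '' C) :
    (z, lowerHeight C z) ∈ frontier C := by
  have hl := lowerHeight_isLeast hC hz
  rw [hC.isClosed.frontier_eq]
  refine ⟨hl.1, ?_⟩
  have := notMem_interior_of_path (S := C) (γ := fun t : ℝ => (z, lowerHeight C z - t))
    (by fun_prop) one_pos fun t ht hmem => by
      have := hl.2 hmem
      linarith [ht.1]
  simpa using this

end Height

/-! ### Exit times of segments towards the point (0, 1) -/

section Depth

variable {W : Type*} [NormedAddCommGroup W] [NormedSpace ℝ W]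

/-- The parameters `s ∈ [0, 1]` for which the segment from a point of `C` above `z` to the point
`(0, 1)` is still in `C` at time `s`. -/
def depthSet (C : Set (W × ℝ)) (z : W) : Set ℝ :=
  {s | s ∈ Set.Icc (0 : ℝ) 1 ∧ ∃ t, (z, t) ∈ C ∧ ((1 - s) • z, (1 - s) * t + s) ∈ C}

/-- The largest element of `depthSet`. -/
noncomputable def depth (C : Set (W × ℝ)) (z : W) : ℝ := sSup (depthSet C z)

variable {C : Set (W × ℝ)} {z : W}

theorem depthSet_subset : depthSet C z ⊆ Set.Icc 0 1 := fun _ hs => hs.1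

theorem zero_mem_depthSet (hz : z ∈ Prod.fst '' C) : 0 ∈ depthSet C z := by
  obtain ⟨⟨z', t⟩, ht, rfl⟩ := hz
  exact ⟨by simp, t, ht, by simpa using ht⟩

theorem depthSet_eq_empty (hz : z ∉ Prod.fst '' C) : depthSet C z = ∅ :=
  Set.eq_empty_of_forall_notMem fun _ ⟨_, _, ht, _⟩ => hz ⟨_, ht, rfl⟩

theorem depth_of_notMem (hz : z ∉ Prod.fst '' C) : depth C z = 0 := by
  rw [depth, depthSet_eq_empty hz, Real.sSup_empty]

theorem bddAbove_depthSet : BddAbove (depthSet C z) := ⟨1, fun _ hs => (depthSet_subset hs).2⟩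

theorem depth_mem_Icc : depth C z ∈ Set.Icc (0 : ℝ) 1 :=
  ⟨Real.sSup_nonneg fun _ hs => (depthSet_subset hs).1,
    Real.sSup_le (fun _ hs => (depthSet_subset hs).2) zero_le_one⟩

theorem isCompact_depthSet (hC : IsCompact C) : IsCompact (depthSet C z) := by
  have : depthSet C z = Prod.fst '' ((Set.Icc (0 : ℝ) 1 ×ˢ (Prod.snd '' C)) ∩
      {p : ℝ × ℝ | (z, p.2) ∈ C ∧ ((1 - p.1) • z, (1 - p.1) * p.2 + p.1) ∈ C}) := by
    ext s
    constructor
    · rintro ⟨hs, t, h1, h2⟩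
      exact ⟨(s, t), ⟨⟨hs, _, h1, rfl⟩, h1, h2⟩, rfl⟩
    · rintro ⟨⟨s, t⟩, ⟨⟨hs, _⟩, h1, h2⟩, rfl⟩
      exact ⟨hs, t, h1, h2⟩
  rw [this]
  refine IsCompact.image ?_ continuous_fst
  refine (isCompact_Icc.prod (hC.image continuous_snd)).inter_right ?_
  exact (hC.isClosed.preimage (f := fun p : ℝ × ℝ => (z, p.2)) (by fun_prop)).inter
    (hC.isClosed.preimage (f := fun p : ℝ × ℝ => ((1 - p.1) • z, (1 - p.1) * p.2 + p.1))
      (by fun_prop))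

theorem depth_mem_depthSet (hC : IsCompact C) (hz : z ∈ Prod.fst '' C) :
    depth C z ∈ depthSet C z :=
  (isCompact_depthSet hC).sSup_mem ⟨0, zero_mem_depthSet hz⟩

theorem mem_depthSet_of_le (hconv : Convex ℝ C) {s r : ℝ} (hs : s ∈ depthSet C z) (hr0 : 0 ≤ r)
    (hrs : r ≤ s) : r ∈ depthSet C z := by
  rcases eq_or_lt_of_le (hr0.trans hrs) with h | h
  · have : r = s := le_antisymm hrs (h ▸ hr0)
    rwa [this]
  obtain ⟨hs1, t, h1, h2⟩ := hs
  refine ⟨⟨hr0, hrs.trans hs1.2⟩, t, h1, ?_⟩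
  have := hconv h1 h2 (sub_nonneg.mpr ((div_le_one h).mpr hrs)) (show 0 ≤ r / s by positivity)
    (by ring)
  convert this using 1
  ext
  · simp only [Prod.fst_add, Prod.smul_fst, smul_smul, ← add_smul]
    congr 1
    field_simp
    ring
  · simp only [Prod.snd_add, Prod.smul_snd, smul_eq_mul]
    field_simp
    ring

theorem le_depth_iff (hC : IsCompact C) (hconv : Convex ℝ C) {s : ℝ} (hs : 0 < s) :
    s ≤ depth C z ↔ s ∈ depthSet C z := by
  refine ⟨fun h => ?_, fun h => le_csSup bddAbove_depthSet h⟩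
  have hz : z ∈ Prod.fst '' C := by
    by_contra hz
    rw [depth_of_notMem hz] at h
    linarith
  exact mem_depthSet_of_le hconv (depth_mem_depthSet hC hz) hs.le h

/-- Since `depthSet` allows any starting height over z, the superlevel set is the projection of a
compact set. This is what makes `depth` measurable. -/
theorem isCompact_setOf_le_depth (hC : IsCompact C) (hconv : Convex ℝ C) {s : ℝ} (hs : 0 < s) :
    IsCompact {z | s ≤ depth C z} := by
  by_cases hs1 : s ≤ 1
  · have : {z | s ≤ depth C z} =
        Prod.fst '' (C ∩ {p : W × ℝ | ((1 - s) • p.1, (1 - s) * p.2 + s) ∈ C}) := by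
      ext z
      rw [Set.mem_ofPred_eq, le_depth_iff hC hconv hs]
      constructor
      · rintro ⟨_, t, h1, h2⟩
        exact ⟨(z, t), ⟨h1, h2⟩, rfl⟩
      · rintro ⟨⟨z, t⟩, ⟨h1, h2⟩, rfl⟩
        exact ⟨⟨hs.le, hs1⟩, t, h1, h2⟩
    rw [this]
    refine (hC.inter_right ?_).image continuous_fst
    exact hC.isClosed.preimage (f := fun p : W × ℝ => ((1 - s) • p.1, (1 - s) * p.2 + s))
      (by fun_prop)
  · convert isCompact_empty
    refine Set.eq_empty_of_forall_notMem fun z hz => hs1 ?_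
    exact (show s ≤ depth C z from hz).trans depth_mem_Icc.2

theorem measurable_depth [MeasurableSpace W] [BorelSpace W] (hC : IsCompact C)
    (hconv : Convex ℝ C) : Measurable (depth C) := by
  refine measurable_of_Ici fun s => ?_
  rcases le_or_gt s 0 with hs | hs
  · convert MeasurableSet.univ
    exact Set.eq_univ_of_forall fun z => hs.trans depth_mem_Icc.1
  · exact (isCompact_setOf_le_depth hC hconv hs).isClosed.measurableSet

/-- Convexity with the origin puts the point at height (1 - s) · `lowerHeight C z` in C. The
vertical section over (1 - s)z is an interval, so it contains everything from there up to u. -/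
theorem mem_of_le_height (hC : IsCompact C) (hconv : Convex ℝ C) (h0 : (0, 0) ∈ C)
    (hz : z ∈ Prod.fst '' C) {s u : ℝ} (hs0 : 0 ≤ s) (hs1 : s ≤ 1)
    (hu : (1 - s) * lowerHeight C z + s ≤ u) (hmem : ((1 - s) • z, u) ∈ C) :
    ((1 - s) • z, (1 - s) * lowerHeight C z + s) ∈ C := by
  have hlow : ((1 - s) • z, (1 - s) * lowerHeight C z) ∈ C := by
    have := hconv (lowerHeight_isLeast hC hz).1 h0 (sub_nonneg.mpr hs1) hs0 (by ring)
    simpa using this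
  have hsec : Convex ℝ {t : ℝ | ((1 - s) • z, t) ∈ C} := by
    intro a ha b hb α β hα hβ hαβ
    have := hconv ha hb hα hβ hαβ
    simpa [← add_smul, hαβ] using this
  exact hsec.ordConnected.out hlow hmem ⟨by linarith, hu⟩

theorem mem_of_mem_depthSet (hC : IsCompact C) (hconv : Convex ℝ C) (h0 : (0, 0) ∈ C)
    {s : ℝ} (hs : s ∈ depthSet C z) :
    ((1 - s) • z, (1 - s) * lowerHeight C z + s) ∈ C := by
  obtain ⟨⟨hs0, hs1⟩, t, h1, h2⟩ := hs
  have hz : z ∈ Prod.fst '' C := ⟨_, h1, rfl⟩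
  refine mem_of_le_height hC hconv h0 hz hs0 hs1 ?_ h2
  have := mul_le_mul_of_nonneg_left ((lowerHeight_isLeast hC hz).2 h1) (sub_nonneg.mpr hs1)
  linarith

theorem mem_iff_le_depth (hC : IsCompact C) (hconv : Convex ℝ C) (h0 : (0, 0) ∈ C)
    (hz : z ∈ Prod.fst '' C) {s : ℝ} (hs : s ∈ Set.Icc (0 : ℝ) 1) :
    ((1 - s) • z, (1 - s) * lowerHeight C z + s) ∈ C ↔ s ≤ depth C z := by
  constructor
  · exact fun h => le_csSup bddAbove_depthSet ⟨hs, _, (lowerHeight_isLeast hC hz).1, h⟩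
  · exact fun h => mem_of_mem_depthSet hC hconv h0
      (mem_depthSet_of_le hconv (depth_mem_depthSet hC hz) hs.1 h)

theorem depth_lt_one (hC : IsCompact C) (h1 : ((0 : W), (1 : ℝ)) ∉ C) : depth C z < 1 := by
  refine lt_of_le_of_ne depth_mem_Icc.2 fun h => ?_
  by_cases hz : z ∈ Prod.fst '' C
  · obtain ⟨_, t, _, h2⟩ := depth_mem_depthSet hC hz
    rw [h] at h2
    exact h1 (by simpa using h2)
  · rw [depth_of_notMem hz] at h
    norm_num at h

/-- A suitable convex combination of the two exit points lies over M⁻¹(αy + βz), where M is the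
weighted mean of the two values of 1/(1 - `depth`). Convexity of `lowerHeight` places it at or above
the segment from the lowest point over αy + βz at time 1 - M⁻¹, so that segment is still in C at
that time. -/
theorem concaveOn_inv_one_sub_depth (hC : IsCompact C) (hconv : Convex ℝ C) (h0 : (0, 0) ∈ C)
    (h1 : ((0 : W), (1 : ℝ)) ∉ C) :
    ConcaveOn ℝ (Prod.fst '' C) fun z => (1 - depth C z)⁻¹ := by
  refine ⟨hconv.is_linear_image (IsLinearMap.mk (fun _ _ => rfl) fun _ _ => rfl), ?_⟩
  intro y hy z hz α β hα hβ hαβ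
  have hA : 0 < 1 - depth C y := sub_pos.mpr (depth_lt_one hC h1)
  have hB : 0 < 1 - depth C z := sub_pos.mpr (depth_lt_one hC h1)
  have hA1 : 1 - depth C y ≤ 1 := by linarith [(depth_mem_Icc (C := C) (z := y)).1]
  have hB1 : 1 - depth C z ≤ 1 := by linarith [(depth_mem_Icc (C := C) (z := z)).1]
  have hp := mem_of_mem_depthSet hC hconv h0 (depth_mem_depthSet hC hy)
  have hq := mem_of_mem_depthSet hC hconv h0 (depth_mem_depthSet hC hz)
  rw [show depth C y = 1 - (1 - depth C y) by ring, sub_sub_cancel] at hp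
  rw [show depth C z = 1 - (1 - depth C z) by ring, sub_sub_cancel] at hq
  simp only [smul_eq_mul]
  generalize 1 - depth C y = A at *
  generalize 1 - depth C z = B at *
  have hly := (lowerHeight_isLeast hC hy).1
  have hlz := (lowerHeight_isLeast hC hz).1
  have hmid := hconv hly hlz hα hβ hαβ
  have hw : α • y + β • z ∈ Prod.fst '' C := ⟨_, hmid, rfl⟩
  have hlw : lowerHeight C (α • y + β • z) ≤ α * lowerHeight C y + β * lowerHeight C z :=
    (lowerHeight_isLeast hC hw).2 hmid
  set M := α * A⁻¹ + β * B⁻¹ with hM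
  have hM1 : 1 ≤ M := by
    have h2 := mul_le_mul_of_nonneg_left ((one_le_inv₀ hA).mpr hA1) hα
    have h3 := mul_le_mul_of_nonneg_left ((one_le_inv₀ hB).mpr hB1) hβ
    linarith
  have hM0 : 0 < M := by linarith
  have hMi : M⁻¹ ≤ 1 := inv_le_one_of_one_le₀ hM1
  -- The weights α/(AM) and β/(BM) cancel the contractions A and B, so the base point becomes a
  -- multiple of αy + βz.
  have hcomb := hconv hp hq (show 0 ≤ α * A⁻¹ * M⁻¹ by positivity)
    (show 0 ≤ β * B⁻¹ * M⁻¹ by positivity) (by rw [← add_mul, ← hM, mul_inv_cancel₀ hM0.ne'])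
  have e1 : (α * A⁻¹ * M⁻¹) • A • y + (β * B⁻¹ * M⁻¹) • B • z =
      (1 - (1 - M⁻¹)) • (α • y + β • z) := by
    rw [sub_sub_cancel, smul_add, smul_smul, smul_smul, smul_smul, smul_smul]
    congr 2
    · field_simp
    · field_simp
  have hu : (1 - (1 - M⁻¹)) * lowerHeight C (α • y + β • z) + (1 - M⁻¹) ≤
      (α * A⁻¹ * M⁻¹) * (A * lowerHeight C y + (1 - A)) +
        (β * B⁻¹ * M⁻¹) * (B * lowerHeight C z + (1 - B)) := by
    have e2 : (α * A⁻¹ * M⁻¹) * (A * lowerHeight C y + (1 - A)) +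
        (β * B⁻¹ * M⁻¹) * (B * lowerHeight C z + (1 - B)) =
          M⁻¹ * (α * lowerHeight C y + β * lowerHeight C z) + (M - (α + β)) * M⁻¹ := by
      rw [hM]
      field_simp
      ring
    rw [e2, hαβ, sub_sub_cancel, sub_mul, mul_inv_cancel₀ hM0.ne', one_mul]
    have := mul_le_mul_of_nonneg_left hlw (inv_nonneg.mpr hM0.le)
    linarith
  have hcomb' : ((1 - (1 - M⁻¹)) • (α • y + β • z),
      (α * A⁻¹ * M⁻¹) * (A * lowerHeight C y + (1 - A)) +
        (β * B⁻¹ * M⁻¹) * (B * lowerHeight C z + (1 - B))) ∈ C := by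
    rw [← e1]
    exact hcomb
  have hs : 1 - M⁻¹ ∈ Set.Icc (0 : ℝ) 1 :=
    ⟨sub_nonneg.mpr hMi, by linarith [inv_nonneg.mpr hM0.le]⟩
  have := (mem_iff_le_depth hC hconv h0 hw hs).mp
    (mem_of_le_height hC hconv h0 hw hs.1 hs.2 hu hcomb')
  rw [le_inv_comm₀ hM0 (sub_pos.mpr (depth_lt_one hC h1))]
  linarith

/-- Concavity of 1/(1 - `depth`), whose value at y is at least 1, reduces this to (1 + 1/(1 - 2t))/2
≥ 1/(1 - t), that is (1 - t)² ≥ 1 - 2t. -/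
theorem le_depth_midpoint (hC : IsCompact C) (hconv : Convex ℝ C) (h0 : (0, 0) ∈ C)
    (h1 : ((0 : W), (1 : ℝ)) ∉ C) {y : W} (hy : y ∈ Prod.fst '' C) (hz : z ∈ Prod.fst '' C) {t : ℝ}
    (ht : 2 * t ≤ depth C z) : t ≤ depth C ((2⁻¹ : ℝ) • (y + z)) := by
  have h := (concaveOn_inv_one_sub_depth hC hconv h0 h1).2 hy hz (show (0 : ℝ) ≤ 2⁻¹ by norm_num)
    (show (0 : ℝ) ≤ 2⁻¹ by norm_num) (by norm_num)
  simp only [smul_eq_mul, ← smul_add] at h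
  have hy1 : 0 < 1 - depth C y := sub_pos.mpr (depth_lt_one hC h1)
  have hz1 : 0 < 1 - depth C z := sub_pos.mpr (depth_lt_one hC h1)
  have hw1 : 0 < 1 - depth C ((2⁻¹ : ℝ) • (y + z)) := sub_pos.mpr (depth_lt_one hC h1)
  have hy2 : 1 ≤ (1 - depth C y)⁻¹ :=
    (one_le_inv₀ hy1).mpr (by linarith [(depth_mem_Icc (C := C) (z := y)).1])
  generalize 1 - depth C y = A at *
  have hw2 := mul_inv_cancel₀ hw1.ne'
  have hz2 := mul_inv_cancel₀ hz1.ne'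
  generalize (1 - depth C ((2⁻¹ : ℝ) • (y + z)))⁻¹ = X at *
  generalize depth C ((2⁻¹ : ℝ) • (y + z)) = w at *
  have hY : 0 < (1 - depth C z)⁻¹ := inv_pos.mpr hz1
  generalize (1 - depth C z)⁻¹ = Y at *
  generalize depth C z = d at *
  by_contra! hcon
  nlinarith [sq_nonneg (1 - (1 - d) * Y), sq_nonneg (Y - 1), mul_pos hw1 hY,
    mul_le_mul_of_nonneg_left h hw1.le, sq_nonneg w, sq_nonneg d]

theorem depth_mem_frontier (hC : IsCompact C) (hconv : Convex ℝ C) (h0 : (0, 0) ∈ C)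
    (h1 : ((0 : W), (1 : ℝ)) ∉ C) (hz : z ∈ Prod.fst '' C) :
    ((1 - depth C z) • z, (1 - depth C z) * lowerHeight C z + depth C z) ∈ frontier C := by
  rw [hC.isClosed.frontier_eq]
  refine ⟨mem_of_mem_depthSet hC hconv h0 (depth_mem_depthSet hC hz), ?_⟩
  have hlt := sub_pos.mpr (depth_lt_one (z := z) hC h1)
  have := notMem_interior_of_path (S := C) (γ := fun t : ℝ =>
    ((1 - (depth C z + t)) • z, (1 - (depth C z + t)) * lowerHeight C z + (depth C z + t)))
    (by fun_prop) hlt fun t ht hmem => by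
      have hs : depth C z + t ∈ Set.Icc (0 : ℝ) 1 :=
        ⟨by linarith [ht.1, (depth_mem_Icc (C := C) (z := z)).1], by linarith [ht.2]⟩
      have := (mem_iff_le_depth hC hconv h0 hz hs).mp hmem
      linarith [ht.1]
  simpa using this

end Depth

/-! ### Hausdorff measure and coordinates along the direction x -/

section EuclideanHausdorff

theorem _root_.LipschitzOnWith.euclideanHausdorffMeasure_image_le {X Y : Type*} [EMetricSpace X]
    [MeasurableSpace X] [BorelSpace X] [EMetricSpace Y] [MeasurableSpace Y] [BorelSpace Y]
    {f : X → Y} {s : Set X} (hf : LipschitzOnWith 1 f s) (n : ℕ) : μHE[n] (f '' s) ≤ μHE[n] s := by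
  simp only [Measure.euclideanHausdorffMeasure_def, Measure.smul_apply, ENNReal.smul_def,
    smul_eq_mul]
  refine mul_le_mul_right ?_ _
  simpa using hf.hausdorffMeasure_image_le (d := n) n.cast_nonneg

/-- The value of the constant is irrelevant: it cancels in the depth/distance ratio. -/
theorem exists_euclideanHausdorffMeasure_one_segment (E : Type*) [NormedAddCommGroup E]
    [NormedSpace ℝ E] [MeasurableSpace E] [BorelSpace E] :
    ∃ c : ℝ, 0 < c ∧ ∀ a b : E, (μHE[1] : Measure E).real (segment ℝ a b) = c * dist a b := by
  refine ⟨_, NNReal.coe_pos.mpr (pos_iff_ne_zero.mpr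
    (Measure.addHaarScalarFactor_volume_hausdorffMeasure_ne_zero 1)), fun a b => ?_⟩
  have h : (μH[((1 : ℕ) : ℝ)] : Measure E) (segment ℝ a b) = edist a b := by
    simp
  rw [Measure.euclideanHausdorffMeasure_def, measureReal_nnreal_smul_apply, Measure.real, h, edist_dist, ENNReal.toReal_ofReal dist_nonneg]

end EuclideanHausdorff

/-- Orthonormal coordinates on the hyperplane orthogonal to `x`. -/
structure AxialFrame {n : ℕ} (x : EuclideanSpace ℝ (Fin (n + 1))) where
  /-- The embedding of the coordinate space as the hyperplane `x^⊥`. -/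
  incl : EuclideanSpace ℝ (Fin n) →ₗᵢ[ℝ] EuclideanSpace ℝ (Fin (n + 1))
  /-- The coordinates of the orthogonal projection onto `x^⊥`. -/
  proj : EuclideanSpace ℝ (Fin (n + 1)) →L[ℝ] EuclideanSpace ℝ (Fin n)
  proj_incl : ∀ z, proj (incl z) = z
  incl_proj : ∀ y, incl (proj y) = (Submodule.span ℝ {x})ᗮ.starProjection y

theorem nonempty_axialFrame {n : ℕ} {x : EuclideanSpace ℝ (Fin (n + 1))} (hx : x ≠ 0) :
    Nonempty (AxialFrame x) := by
  have : Fact (Module.finrank ℝ (EuclideanSpace ℝ (Fin (n + 1))) = n + 1) := ⟨by simp⟩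
  let b := OrthonormalBasis.fromOrthogonalSpanSingleton (𝕜 := ℝ) n hx
  refine ⟨⟨(Submodule.subtypeₗᵢ _).comp b.repr.symm.toLinearIsometry,
    (b.repr.toContinuousLinearEquiv : _ →L[ℝ] _).comp
      ((Submodule.span ℝ {x})ᗮ.orthogonalProjectionOnto), fun z => ?_, fun y => ?_⟩⟩
  · simp
  · simp

namespace AxialFrame

variable {n : ℕ} {x : EuclideanSpace ℝ (Fin (n + 1))} (F : AxialFrame x)

theorem proj_self : F.proj x = 0 := by
  apply F.incl.injective
  rw [F.incl_proj, map_zero, Submodule.starProjection_orthogonalComplement_singleton_eq_zero]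

theorem inner_incl (z : EuclideanSpace ℝ (Fin n)) : inner ℝ (F.incl z) x = 0 := by
  have h : F.incl z ∈ (Submodule.span ℝ {x})ᗮ := by
    rw [← F.proj_incl z, F.incl_proj]
    exact Submodule.starProjection_apply_mem _ _
  exact Submodule.mem_orthogonal_singleton_iff_inner_left.mp h

theorem lipschitzWith_proj : LipschitzWith 1 F.proj := by
  refine LipschitzWith.of_dist_le_mul fun y z => ?_
  rw [dist_eq_norm, dist_eq_norm, ← map_sub, ← F.incl.norm_map, F.incl_proj, NNReal.coe_one,
    one_mul]
  exact ((Submodule.span ℝ {x})ᗮ.starProjection.le_opNorm _).trans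
    (mul_le_of_le_one_left (norm_nonneg _) (Submodule.starProjection_norm_le _))

theorem incl_proj_add (y : EuclideanSpace ℝ (Fin (n + 1))) :
    F.incl (F.proj y) + (inner ℝ x y / ‖x‖ ^ 2) • x = y := by
  have h := Submodule.starProjection_singleton (𝕜 := ℝ) (v := x) y
  have h2 := Submodule.starProjection_add_starProjection_orthogonal (K := Submodule.span ℝ {x}) y
  rw [h] at h2
  rw [F.incl_proj, add_comm ((Submodule.span ℝ {x})ᗮ.starProjection y)]
  exact h2

/-- The linear parametrisation of space by `x^⊥ × ℝ`. -/
noncomputable def toSpace : EuclideanSpace ℝ (Fin n) × ℝ →L[ℝ] EuclideanSpace ℝ (Fin (n + 1)) :=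
  F.incl.toContinuousLinearMap.coprod (ContinuousLinearMap.toSpanSingleton ℝ x)

/-- The axial coordinates of a point. -/
noncomputable def ofSpace : EuclideanSpace ℝ (Fin (n + 1)) →L[ℝ] EuclideanSpace ℝ (Fin n) × ℝ :=
  F.proj.prod ((‖x‖ ^ 2)⁻¹ • innerSL ℝ x)

theorem toSpace_apply (p : EuclideanSpace ℝ (Fin n) × ℝ) :
    F.toSpace p = F.incl p.1 + p.2 • x := by
  simp [toSpace]

theorem toSpace_ofSpace (y : EuclideanSpace ℝ (Fin (n + 1))) : F.toSpace (F.ofSpace y) = y := by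
  conv_rhs => rw [← F.incl_proj_add y]
  simp [toSpace_apply, ofSpace, div_eq_inv_mul]

theorem inner_toSpace (p : EuclideanSpace ℝ (Fin n) × ℝ) :
    inner ℝ (F.toSpace p) x = p.2 * ‖x‖ ^ 2 := by
  rw [toSpace_apply, inner_add_left, F.inner_incl, inner_smul_left, real_inner_self_eq_norm_sq]
  simp

theorem proj_toSpace (p : EuclideanSpace ℝ (Fin n) × ℝ) : F.proj (F.toSpace p) = p.1 := by
  rw [toSpace_apply, map_add, F.proj_incl, map_smul, F.proj_self, smul_zero, add_zero]

theorem ofSpace_toSpace (hx : x ≠ 0) (p : EuclideanSpace ℝ (Fin n) × ℝ) :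
    F.ofSpace (F.toSpace p) = p := by
  ext1
  · simp [ofSpace, proj_toSpace]
  · have : ‖x‖ ≠ 0 := norm_ne_zero_iff.mpr hx
    change (‖x‖ ^ 2)⁻¹ * inner ℝ x (F.toSpace p) = p.2
    rw [real_inner_comm, inner_toSpace]
    field_simp

/-- The set `K` in axial coordinates. -/
def coordSet (K : Set (EuclideanSpace ℝ (Fin (n + 1)))) : Set (EuclideanSpace ℝ (Fin n) × ℝ) :=
  F.toSpace ⁻¹' K

variable {F} {K : Set (EuclideanSpace ℝ (Fin (n + 1)))}

theorem coordSet_eq_image (hx : x ≠ 0) : F.coordSet K = F.ofSpace '' K := by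
  ext p
  constructor
  · exact fun hp => ⟨_, hp, F.ofSpace_toSpace hx p⟩
  · rintro ⟨y, hy, rfl⟩
    rw [coordSet, Set.mem_preimage, F.toSpace_ofSpace]
    exact hy

theorem isCompact_coordSet (hx : x ≠ 0) (hK : IsCompact K) : IsCompact (F.coordSet K) := by
  rw [coordSet_eq_image hx]
  exact hK.image F.ofSpace.continuous

theorem convex_coordSet (hK : Convex ℝ K) : Convex ℝ (F.coordSet K) :=
  hK.linear_preimage F.toSpace.toLinearMap

theorem toSpace_mem_frontier {p : EuclideanSpace ℝ (Fin n) × ℝ}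
    (hp : p ∈ frontier (F.coordSet K)) : F.toSpace p ∈ frontier K :=
  F.toSpace.continuous.frontier_preimage_subset _ hp

theorem fst_image_coordSet : Prod.fst '' F.coordSet K = F.proj '' K := by
  ext z
  constructor
  · rintro ⟨p, hp, rfl⟩
    exact ⟨_, hp, F.proj_toSpace p⟩
  · rintro ⟨y, hy, rfl⟩
    refine ⟨F.ofSpace y, ?_, rfl⟩
    rw [coordSet, Set.mem_preimage, F.toSpace_ofSpace]
    exact hy

theorem shadow_eq_image : shadow x K = F.incl '' (Prod.fst '' F.coordSet K) := by
  rw [fst_image_coordSet, Set.image_image, shadow]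
  simp only [F.incl_proj]

theorem euclideanHausdorffMeasure_incl_image (S : Set (EuclideanSpace ℝ (Fin n))) :
    μHE[n] (F.incl '' S) = volume S := by
  rw [F.incl.isometry.euclideanHausdorffMeasure_image,
    EuclideanSpace.euclideanHausdorffMeasure_eq_volume]

theorem setIntegral_incl_image (S : Set (EuclideanSpace ℝ (Fin n)))
    (φ : EuclideanSpace ℝ (Fin (n + 1)) → ℝ) :
    ∫ y in F.incl '' S, φ y ∂μHE[n] = ∫ z in S, φ (F.incl z) := by
  have hemb : MeasurableEmbedding F.incl := F.incl.isometry.isClosedEmbedding.measurableEmbedding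
  have h := F.incl.isometry.map_euclideanHausdorffMeasure (d := n)
  rw [EuclideanSpace.euclideanHausdorffMeasure_eq_volume] at h
  have h2 := hemb.setIntegral_map (μ := volume) φ (F.incl '' S)
  rw [h, Measure.restrict_restrict_of_subset (Set.image_subset_range _ _),
    Set.preimage_image_eq _ F.incl.injective] at h2
  exact h2

/-- S lies in the projection of T, and the projection is 1-Lipschitz. This is the only way surface
measure is bounded below. -/
theorem volume_preimage_le_of_proj_eq {S : Set (EuclideanSpace ℝ (Fin n))}
    {T : Set (EuclideanSpace ℝ (Fin (n + 1)))} (h : ∀ z ∈ S, ∃ y ∈ T, F.proj y = z) :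
    volume S ≤ μHE[n] T := by
  have := (F.lipschitzWith_proj.lipschitzOnWith (s := T)).euclideanHausdorffMeasure_image_le n
  rw [EuclideanSpace.euclideanHausdorffMeasure_eq_volume] at this
  exact (measure_mono h).trans this

theorem farPoint_incl (hx : x ≠ 0) (hK : IsCompact K) {z : EuclideanSpace ℝ (Fin n)}
    (hz : z ∈ Prod.fst '' F.coordSet K) :
    farPoint K x (F.incl z) = F.toSpace (z, lowerHeight (F.coordSet K) z) := by
  have hl := lowerHeight_isLeast (isCompact_coordSet hx hK) hz
  have hx2 : 0 < ‖x‖ ^ 2 := by positivity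
  have hex : ∃ y, y ∈ K ∩ Set.range (fun t : ℝ => F.incl z + t • x) ∧
      IsMinOn (fun w => inner ℝ w x) (K ∩ Set.range (fun t : ℝ => F.incl z + t • x)) y := by
    refine ⟨F.toSpace (z, lowerHeight (F.coordSet K) z), ⟨hl.1, _, (F.toSpace_apply (z, _)).symm⟩, ?_⟩
    rintro _ ⟨hy, t, rfl⟩
    have e : F.incl z + t • x = F.toSpace (z, t) := (F.toSpace_apply (z, t)).symm
    simp only [e] at hy ⊢
    simp only [Set.mem_ofPred_eq, F.inner_toSpace]
    exact mul_le_mul_of_nonneg_right (hl.2 hy) hx2.le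
  obtain ⟨⟨h1, t, ht⟩, h2⟩ := Classical.epsilon_spec hex
  change farPoint K x (F.incl z) ∈ K at h1
  change F.incl z + t • x = farPoint K x (F.incl z) at ht
  change IsMinOn _ _ (farPoint K x (F.incl z)) at h2
  have e : F.incl z + t • x = F.toSpace (z, t) := (F.toSpace_apply (z, t)).symm
  rw [e] at ht
  rw [← ht] at h1 h2 ⊢
  have h3 := h2 (show F.toSpace (z, lowerHeight (F.coordSet K) z) ∈ _ from
    ⟨hl.1, _, (F.toSpace_apply (z, _)).symm⟩)
  simp only [Set.mem_ofPred_eq, F.inner_toSpace] at h3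
  have h4 : t ≤ lowerHeight (F.coordSet K) z := le_of_mul_le_mul_right h3 hx2
  rw [le_antisymm h4 (hl.2 h1)]

end AxialFrame

namespace AxialFrame

variable {n : ℕ} {x : EuclideanSpace ℝ (Fin (n + 1))} {F : AxialFrame x}
  {K : Set (EuclideanSpace ℝ (Fin (n + 1)))} {z : EuclideanSpace ℝ (Fin n)}

theorem toSpace_zero_one : F.toSpace (0, 1) = x := by
  simp [toSpace_apply]

theorem toSpace_lineMap (z : EuclideanSpace ℝ (Fin n)) (a u : ℝ) :
    F.toSpace ((1 - u) • z, (1 - u) * a + u) = AffineMap.lineMap (F.toSpace (z, a)) x u := by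
  rw [AffineMap.lineMap_apply_module]
  simp only [toSpace_apply, map_smul]
  module

theorem zero_mem_coordSet (h0 : 0 ∈ K) : (0, 0) ∈ F.coordSet K := by
  rw [coordSet, Set.mem_preimage, toSpace_apply]
  simpa using h0

theorem zero_one_mem_coordSet_iff : (0, 1) ∈ F.coordSet K ↔ x ∈ K := by
  rw [coordSet, Set.mem_preimage, toSpace_zero_one]

/-- By the membership criterion for `depth`, K meets the segment from the far point p to x exactly
in its initial piece up to time `depth`; the ratio of lengths is therefore that time. -/
theorem depthRatio_incl (hK : IsCompact K) (hconv : Convex ℝ K) (h0 : 0 ∈ K) (hxK : x ∉ K)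
    (hz : z ∈ Prod.fst '' F.coordSet K) :
    depthRatio K x (F.incl z) = depth (F.coordSet K) z := by
  have hx : x ≠ 0 := fun h => hxK (h ▸ h0)
  have cC := isCompact_coordSet (F := F) hx hK
  have vC := convex_coordSet (F := F) hconv
  have zC := zero_mem_coordSet (F := F) h0
  set s := depth (F.coordSet K) z with hs
  set p := F.toSpace (z, lowerHeight (F.coordSet K) z) with hp
  have hmem : ∀ u ∈ Set.Icc (0 : ℝ) 1, AffineMap.lineMap p x u ∈ K ↔ u ≤ s := fun u hu => by
    rw [hp, ← toSpace_lineMap]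
    exact mem_iff_le_depth cC vC zC hz hu
  have hs01 : s ∈ Set.Icc (0 : ℝ) 1 := depth_mem_Icc
  have hpK : p ∈ K := (lowerHeight_isLeast cC hz).1
  have hseg : K ∩ segment ℝ x p = segment ℝ p (AffineMap.lineMap p x s) := by
    rw [segment_symm]
    apply Set.Subset.antisymm
    · rintro y ⟨hyK, hy⟩
      rw [segment_eq_image_lineMap] at hy
      obtain ⟨u, hu, rfl⟩ := hy
      have hus := (hmem u hu).mp hyK
      rw [segment_eq_image_lineMap]
      rcases eq_or_lt_of_le hs01.1 with h | h
      · have : u = 0 := le_antisymm (hus.trans h.ge) hu.1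
        exact ⟨0, by simp, by simp [this]⟩
      · refine ⟨u / s, ⟨div_nonneg hu.1 h.le, (div_le_one h).mpr hus⟩, ?_⟩
        simp only [AffineMap.lineMap_apply, vsub_eq_sub, vadd_eq_add, add_sub_cancel_right,
          smul_smul, div_mul_cancel₀ _ h.ne']
    · refine Set.subset_inter (hconv.segment_subset hpK ((hmem s hs01).mpr le_rfl)) ?_
      refine (convex_segment p x).segment_subset (left_mem_segment ℝ p x) ?_
      rw [segment_eq_image_lineMap]
      exact ⟨s, hs01, rfl⟩
  obtain ⟨c, hc, hlen⟩ :=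
    exists_euclideanHausdorffMeasure_one_segment (EuclideanSpace ℝ (Fin (n + 1)))
  rw [depthRatio, farPoint_incl hx hK hz, ← hp, hseg, hlen, hlen, dist_left_lineMap,
    Real.norm_eq_abs, abs_of_nonneg hs01.1, dist_comm x p]
  have hd : dist p x ≠ 0 := dist_ne_zero.mpr fun h => hxK (h ▸ hpK)
  field_simp

theorem depthRatio_incl_of_mem (hx : x ≠ 0) (hK : IsCompact K) (hconv : Convex ℝ K) (h0 : 0 ∈ K)
    (hxK : x ∈ K) (hz : z ∈ Prod.fst '' F.coordSet K) : depthRatio K x (F.incl z) = 1 := by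
  have hl := lowerHeight_isLeast (isCompact_coordSet (F := F) hx hK) hz
  obtain ⟨c, hc, hlen⟩ :=
    exists_euclideanHausdorffMeasure_one_segment (EuclideanSpace ℝ (Fin (n + 1)))
  rw [depthRatio, farPoint_incl hx hK hz,
    Set.inter_eq_right.mpr (hconv.segment_subset hxK hl.1), hlen]
  refine div_self (mul_ne_zero hc.ne' (dist_ne_zero.mpr fun h => ?_))
  have h1 : F.ofSpace (F.toSpace (0, 1)) =
      F.ofSpace (F.toSpace (z, lowerHeight (F.coordSet K) z)) := by
    rw [toSpace_zero_one]
    exact congrArg F.ofSpace h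
  rw [F.ofSpace_toSpace hx, F.ofSpace_toSpace hx] at h1
  obtain ⟨rfl, h2⟩ := Prod.mk.inj h1
  have := hl.2 (zero_mem_coordSet (F := F) h0)
  linarith

theorem avgDepthRatio_eq (F : AxialFrame x) :
    avgDepthRatio K x = (volume.real (Prod.fst '' F.coordSet K))⁻¹ *
      ∫ z in Prod.fst '' F.coordSet K, depthRatio K x (F.incl z) := by
  rw [avgDepthRatio, shadow_eq_image (F := F), Nat.add_sub_cancel, Measure.real,
    euclideanHausdorffMeasure_incl_image, setIntegral_incl_image, Measure.real]

theorem ball_subset_fst_image {c : EuclideanSpace ℝ (Fin (n + 1))} {r : ℝ}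
    (h : Metric.ball c r ⊆ K) : Metric.ball (F.proj c) r ⊆ Prod.fst '' F.coordSet K := by
  intro z hz
  rw [fst_image_coordSet]
  refine ⟨c + F.incl (z - F.proj c), h ?_, ?_⟩
  · rw [mem_ball_iff_norm, add_sub_cancel_left, F.incl.norm_map]
    exact mem_ball_iff_norm.mp hz
  · rw [map_add, F.proj_incl, add_sub_cancel]

theorem measurableSet_fst_image (hx : x ≠ 0) (hK : IsCompact K) :
    MeasurableSet (Prod.fst '' F.coordSet K) :=
  ((isCompact_coordSet hx hK).image continuous_fst).isClosed.measurableSet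

theorem volume_fst_image_lt_top (hx : x ≠ 0) (hK : IsCompact K) :
    volume (Prod.fst '' F.coordSet K) < ⊤ :=
  ((isCompact_coordSet hx hK).image continuous_fst).measure_lt_top

end AxialFrame

/-! ### Finiteness of surface area and the surface/shadow ratio -/

section SurfaceArea

variable {n : ℕ} {K : Set (EuclideanSpace ℝ (Fin (n + 1)))}

/-- The nearest-point map onto a convex set is `1`-Lipschitz, stated for outward normals. -/
theorem dist_le_dist_of_normal {E : Type*} [NormedAddCommGroup E] [InnerProductSpace ℝ E]
    {y₁ y₂ p₁ p₂ : E} (h1 : inner ℝ (p₁ - y₁) (y₂ - y₁) ≤ 0)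
    (h2 : inner ℝ (p₂ - y₂) (y₁ - y₂) ≤ 0) : dist y₁ y₂ ≤ dist p₁ p₂ := by
  rw [dist_eq_norm, dist_eq_norm]
  have key : ‖y₁ - y₂‖ ^ 2 ≤ inner ℝ (p₁ - p₂) (y₁ - y₂) := by
    rw [← real_inner_self_eq_norm_sq]
    simp only [inner_sub_left, inner_sub_right] at *
    linarith
  have hcs := real_inner_le_norm (p₁ - p₂) (y₁ - y₂)
  rcases eq_or_lt_of_le (norm_nonneg (y₁ - y₂)) with h | h
  · rw [← h]; exact norm_nonneg _
  · refine le_of_mul_le_mul_right ?_ h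
    rw [← sq]
    exact key.trans hcs

/-- Hahn–Banach separates y from the open set `interior K`; the inequality extends to K because K
lies in the closure of its interior. -/
theorem exists_outward_normal {E : Type*} [NormedAddCommGroup E] [InnerProductSpace ℝ E]
    [CompleteSpace E] {K : Set E} (hconv : Convex ℝ K) (hint : (interior K).Nonempty) {y : E}
    (hy : y ∉ interior K) : ∃ u : E, u ≠ 0 ∧ ∀ w ∈ K, inner ℝ u (w - y) ≤ 0 := by
  obtain ⟨f, hf⟩ := geometric_hahn_banach_open_point hconv.interior isOpen_interior hy
  obtain ⟨w₀, hw₀⟩ := hint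
  refine ⟨(InnerProductSpace.toDual ℝ E).symm f, fun h => ?_, fun w hw => ?_⟩
  · rw [LinearIsometryEquiv.map_eq_zero_iff] at h
    have := hf w₀ hw₀
    simp [h] at this
  · rw [InnerProductSpace.toDual_symm_apply, map_sub, sub_nonpos]
    have hw' : w ∈ closure (interior K) := by
      rw [hconv.closure_interior_eq_closure_of_nonempty_interior ⟨w₀, hw₀⟩]
      exact subset_closure hw
    have hcl : IsClosed {v | f v ≤ f y} := isClosed_le f.continuous continuous_const
    exact closure_minimal (fun v hv => (hf v hv).le) hcl hw'

theorem isometry_insertNth (i : Fin (n + 1)) (c : ℝ) :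
    Isometry fun z : EuclideanSpace ℝ (Fin n) =>
      (WithLp.toLp 2 (i.insertNth c z.ofLp) : EuclideanSpace ℝ (Fin (n + 1))) := by
  refine Isometry.of_dist_eq fun y z => ?_
  rw [EuclideanSpace.dist_eq, EuclideanSpace.dist_eq, Fin.sum_univ_succAbove _ i]
  simp

/-- The sup-norm sphere is covered by 2(n + 1) faces, each an isometric copy of a bounded set in
dimension n. -/
theorem euclideanHausdorffMeasure_cube_boundary_lt_top (R : ℝ) :
    μHE[n] {p : EuclideanSpace ℝ (Fin (n + 1)) | ‖p.ofLp‖ = R} < ⊤ := by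
  let B : Set (EuclideanSpace ℝ (Fin n)) := WithLp.ofLp ⁻¹' Metric.closedBall 0 R
  have hB : volume B < ⊤ := by
    rw [(PiLp.volume_preserving_ofLp (Fin n)).measure_preimage
      Metric.isClosed_closedBall.measurableSet.nullMeasurableSet]
    exact (isCompact_closedBall _ _).measure_lt_top
  have hsub : {p : EuclideanSpace ℝ (Fin (n + 1)) | ‖p.ofLp‖ = R} ⊆
      ⋃ i : Fin (n + 1), ((fun z : EuclideanSpace ℝ (Fin n) =>
        (WithLp.toLp 2 (i.insertNth R z.ofLp) : EuclideanSpace ℝ (Fin (n + 1)))) '' B) ∪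
        ((fun z : EuclideanSpace ℝ (Fin n) =>
        (WithLp.toLp 2 (i.insertNth (-R) z.ofLp) : EuclideanSpace ℝ (Fin (n + 1)))) '' B) := by
    intro p hp
    have hp : ‖p.ofLp‖ = R := hp
    obtain ⟨i, hi⟩ : ∃ i, ‖p.ofLp i‖ = R := by
      by_contra! hne
      have hlt : ∀ i, ‖p.ofLp i‖ < R := fun i =>
        lt_of_le_of_ne ((norm_le_pi_norm _ i).trans_eq hp) (hne i)
      have hR : 0 < R := (norm_nonneg _).trans_lt (hlt 0)
      exact absurd hp ((pi_norm_lt_iff hR).mpr hlt).ne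
    rw [Set.mem_iUnion]
    refine ⟨i, ?_⟩
    have hz : (WithLp.toLp 2 (fun j => p.ofLp (i.succAbove j)) : EuclideanSpace ℝ (Fin n)) ∈ B := by
      simp only [B, Set.mem_preimage, mem_closedBall_zero_iff]
      exact (pi_norm_le_iff_of_nonneg (hp ▸ norm_nonneg _)).mpr fun j =>
        (norm_le_pi_norm p.ofLp _).trans_eq hp
    have hins : ∀ c, p.ofLp i = c →
        (WithLp.toLp 2 (i.insertNth c fun j => p.ofLp (i.succAbove j)) :
          EuclideanSpace ℝ (Fin (n + 1))) = p := by
      rintro c rfl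
      have := Fin.insertNth_self_removeNth i p.ofLp
      exact congrArg (WithLp.toLp 2) this
    rw [Real.norm_eq_abs] at hi
    rcases abs_choice (p.ofLp i) with h | h
    · exact Or.inl ⟨_, hz, hins R (by rw [← h, hi])⟩
    · exact Or.inr ⟨_, hz, hins (-R) (by linarith)⟩
  refine (measure_mono hsub).trans_lt ?_
  refine (measure_iUnion_le _).trans_lt ?_
  rw [tsum_fintype]
  refine ENNReal.sum_lt_top.mpr fun i _ => (measure_union_le _ _).trans_lt ?_
  rw [(isometry_insertNth i R).euclideanHausdorffMeasure_image,
    (isometry_insertNth i (-R)).euclideanHausdorffMeasure_image,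
    EuclideanSpace.euclideanHausdorffMeasure_eq_volume]
  exact ENNReal.add_lt_top.mpr ⟨hB, hB⟩

/-- The boundary of a convex body has finite surface area. -/
theorem euclideanHausdorffMeasure_frontier_lt_top (hK : IsConvexBody K) :
    μHE[n] (frontier K) < ⊤ := by
  have hcont : Continuous fun p : EuclideanSpace ℝ (Fin (n + 1)) => ‖p.ofLp‖ := by fun_prop
  obtain ⟨R, hR⟩ : ∃ R, ∀ y ∈ K, ‖y.ofLp‖ ≤ R := by
    obtain ⟨R, hR⟩ := (hK.isCompact.image hcont).bddAbove
    exact ⟨R, fun y hy => hR ⟨y, hy, rfl⟩⟩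
  -- `G` consists of the points of the surrounding cube's boundary that have a nearest point in K,
  -- expressed by the normal inequality. The nearest-point map `N` is 1-Lipschitz on it and covers
  -- ∂K.
  let G : Set (EuclideanSpace ℝ (Fin (n + 1))) :=
    {p | ‖p.ofLp‖ = R ∧ ∃ y ∈ K, ∀ w ∈ K, inner ℝ (p - y) (w - y) ≤ 0}
  have hex : ∀ p : EuclideanSpace ℝ (Fin (n + 1)), ∃ y, p ∈ G →
      y ∈ K ∧ ∀ w ∈ K, inner ℝ (p - y) (w - y) ≤ 0 := by
    intro p
    by_cases hp : p ∈ G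
    · obtain ⟨y, hy⟩ := hp.2
      exact ⟨y, fun _ => hy⟩
    · exact ⟨0, fun h => absurd h hp⟩
  choose N hN using hex
  have hlip : LipschitzOnWith 1 N G := LipschitzOnWith.of_dist_le_mul fun p hp q hq => by
    rw [NNReal.coe_one, one_mul]
    exact dist_le_dist_of_normal ((hN p hp).2 _ (hN q hq).1) ((hN q hq).2 _ (hN p hp).1)
  have hsub : frontier K ⊆ N '' G := by
    intro y hy
    rw [hK.isCompact.isClosed.frontier_eq] at hy
    obtain ⟨u, hu0, hu⟩ := exists_outward_normal hK.convex hK.interior_nonempty hy.2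
    have hu1 : 0 < ‖u.ofLp‖ := norm_pos_iff.mpr fun h => hu0 (by
      ext i
      exact congrFun h i)
    have hR0 : 0 ≤ R := (norm_nonneg _).trans (hR y hy.1)
    -- The ray from y along its outward normal must cross the cube's boundary, since after length 2R
    -- in sup norm it has norm at least R.
    obtain ⟨s, hs, hsR⟩ : ∃ s ∈ Set.Icc (0 : ℝ) (2 * R / ‖u.ofLp‖), ‖(y + s • u).ofLp‖ = R := by
      have hc : ContinuousOn (fun s : ℝ => ‖(y + s • u).ofLp‖)
          (Set.Icc 0 (2 * R / ‖u.ofLp‖)) := (hcont.comp (by fun_prop)).continuousOn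
      refine intermediate_value_Icc (by positivity) hc ⟨by simpa using hR y hy.1, ?_⟩
      have h1 : ‖((2 * R / ‖u.ofLp‖) • u).ofLp‖ = 2 * R := by
        rw [WithLp.ofLp_smul, norm_smul, Real.norm_of_nonneg (by positivity)]
        field_simp
      have h2 := norm_sub_le (y + (2 * R / ‖u.ofLp‖) • u).ofLp y.ofLp
      rw [← WithLp.ofLp_sub, add_sub_cancel_left, h1] at h2
      linarith [hR y hy.1]
    have hnormal : ∀ w ∈ K, inner ℝ (y + s • u - y) (w - y) ≤ 0 := fun w hw => by
      rw [add_sub_cancel_left, real_inner_smul_left]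
      exact mul_nonpos_of_nonneg_of_nonpos hs.1 (hu w hw)
    have hG : y + s • u ∈ G := ⟨hsR, y, hy.1, hnormal⟩
    refine ⟨_, hG, ?_⟩
    have := dist_le_dist_of_normal ((hN _ hG).2 _ hy.1) (hnormal _ (hN _ hG).1)
    rw [dist_self] at this
    exact dist_le_zero.mp this
  calc μHE[n] (frontier K) ≤ μHE[n] (N '' G) := measure_mono hsub
    _ ≤ μHE[n] G := hlip.euclideanHausdorffMeasure_image_le n
    _ ≤ _ := measure_mono fun p hp => hp.1
    _ < ⊤ := euclideanHausdorffMeasure_cube_boundary_lt_top R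

theorem shadow_smul {d : ℕ} {c : ℝ} (hc : c ≠ 0) (x : EuclideanSpace ℝ (Fin d))
    (K : Set (EuclideanSpace ℝ (Fin d))) : shadow (c • x) K = shadow x K := by
  have : Submodule.span ℝ {c • x} = Submodule.span ℝ {x} :=
    Submodule.span_singleton_smul_eq (IsUnit.mk0 c hc) x
  simp only [shadow, this]

/-- The real supremum is meaningful only if the ratios are bounded: every shadow contains an
n-dimensional ball of the radius of a ball inside K. -/
theorem ratio_le_maxSurfaceShadowRatio (hK : IsConvexBody K)
    {x : EuclideanSpace ℝ (Fin (n + 1))} (hx : x ≠ 0) :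
    (μHE[n] : Measure (EuclideanSpace ℝ (Fin (n + 1)))).real (frontier K) /
      (μHE[n] : Measure (EuclideanSpace ℝ (Fin (n + 1)))).real (shadow x K) ≤
        maxSurfaceShadowRatio K := by
  obtain ⟨c, hc⟩ := hK.interior_nonempty
  obtain ⟨r, hr, hball⟩ := Metric.isOpen_iff.mp isOpen_interior c hc
  have hball' := hball.trans interior_subset
  have hvol : ∀ θ : EuclideanSpace ℝ (Fin (n + 1)), θ ≠ 0 →
      volume.real (Metric.ball (0 : EuclideanSpace ℝ (Fin n)) r) ≤
        (μHE[n] : Measure (EuclideanSpace ℝ (Fin (n + 1)))).real (shadow θ K) := by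
    intro θ hθ
    obtain ⟨F⟩ := nonempty_axialFrame hθ
    rw [AxialFrame.shadow_eq_image (F := F), Measure.real, Measure.real,
      AxialFrame.euclideanHausdorffMeasure_incl_image]
    refine ENNReal.toReal_mono (AxialFrame.volume_fst_image_lt_top hθ hK.isCompact).ne ?_
    rw [← Measure.addHaar_ball_center volume (F.proj c)]
    exact measure_mono (AxialFrame.ball_subset_fst_image hball')
  have hpos : 0 < volume.real (Metric.ball (0 : EuclideanSpace ℝ (Fin n)) r) :=
    ENNReal.toReal_pos (Metric.measure_ball_pos _ _ hr).ne' measure_ball_lt_top.ne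
  have hbdd : BddAbove (Set.range fun θ : Metric.sphere (0 : EuclideanSpace ℝ (Fin (n + 1))) 1 =>
      (μHE[n] : Measure (EuclideanSpace ℝ (Fin (n + 1)))).real (frontier K) /
        (μHE[n] : Measure (EuclideanSpace ℝ (Fin (n + 1)))).real (shadow (θ : _) K)) := by
    refine ⟨(μHE[n] : Measure (EuclideanSpace ℝ (Fin (n + 1)))).real (frontier K) /
      volume.real (Metric.ball (0 : EuclideanSpace ℝ (Fin n)) r), ?_⟩
    rintro _ ⟨θ, rfl⟩
    refine div_le_div_of_nonneg_left measureReal_nonneg hpos (hvol θ ?_)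
    exact ne_zero_of_mem_unit_sphere θ
  have hx0 : ‖x‖⁻¹ ≠ 0 := inv_ne_zero (norm_ne_zero_iff.mpr hx)
  have := le_ciSup hbdd ⟨‖x‖⁻¹ • x, by
    rw [mem_sphere_zero_iff_norm, norm_smul, norm_inv, norm_norm,
      inv_mul_cancel₀ (norm_ne_zero_iff.mpr hx)]⟩
  simp only [shadow_smul hx0] at this
  exact this

end SurfaceArea

/-! ### Transport of integrals, level sets, and the convexity estimate -/

/-- The integrand (f - g)² is only almost everywhere measurable for ρ, while it must be composed
with maps from the shadow. A measurable majorant, infinite on a null set, has the same integral and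
holds pointwise. -/
theorem exists_measurable_ge_lintegral_eq {α : Type*} [MeasurableSpace α] {μ : Measure α}
    {φ : α → ENNReal} (hφ : AEMeasurable φ μ) :
    ∃ H : α → ENNReal, Measurable H ∧ φ ≤ H ∧ ∫⁻ a, H a ∂μ = ∫⁻ a, φ a ∂μ := by
  classical
  set T := toMeasurable μ {a | φ a ≠ hφ.mk φ a}
  have hT : μ T = 0 := by
    rw [measure_toMeasurable]
    exact hφ.ae_eq_mk
  refine ⟨T.piecewise (fun _ => ⊤) (hφ.mk φ), Measurable.piecewise
    (measurableSet_toMeasurable _ _) measurable_const hφ.measurable_mk, fun a => ?_, ?_⟩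
  · by_cases ha : a ∈ T
    · simp [ha]
    · have : φ a = hφ.mk φ a := by
        by_contra h
        exact ha (subset_toMeasurable _ _ h)
      simp [ha, this]
  · refine lintegral_congr_ae ?_
    filter_upwards [hφ.ae_eq_mk, compl_mem_ae_iff.mpr hT] with a h1 h2
    rw [Set.piecewise_eq_of_notMem _ _ _ h2, h1]

theorem setLIntegral_comp_le {α β : Type*} [MeasurableSpace α] [MeasurableSpace β]
    {μ : Measure α} {ν : Measure β} {γ : α → β} (hγ : Measurable γ) {A : Set α}
    {c : ENNReal} (h : ∀ T, MeasurableSet T → μ (A ∩ γ ⁻¹' T) ≤ c * ν T) {H : β → ENNReal}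
    (hH : Measurable H) : ∫⁻ a in A, H (γ a) ∂μ ≤ c * ∫⁻ b, H b ∂ν := by
  rw [← lintegral_map hH hγ, ← smul_eq_mul, ← lintegral_smul_measure]
  refine lintegral_mono' (Measure.le_iff.mpr fun T hT => ?_) le_rfl
  rw [Measure.map_apply hγ hT, Measure.restrict_apply (hγ hT), Set.inter_comm]
  exact h T hT

/-- For an interior point, move slightly from a near-minimiser x₀ of g towards an interior point y₀
of D. Since g is bounded above near y₀, convexity keeps g below the level on a whole neighbourhood.
-/
theorem isConvexBody_levelSet {d : ℕ} {D : Set (EuclideanSpace ℝ (Fin d))} (hD : IsConvexBody D)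
    {g : EuclideanSpace ℝ (Fin d) → ℝ} (hg : ConvexOn ℝ D g) {ε : ℝ} (hε : 0 < ε)
    (hcl : IsClosed (levelSet D g ε)) : IsConvexBody (levelSet D g ε) := by
  refine ⟨hg.convex_le _, hD.isCompact.of_isClosed_subset hcl fun y hy => hy.1, ?_⟩
  obtain ⟨y₀, hy₀⟩ := hD.interior_nonempty
  obtain ⟨_, ⟨x₀, hx₀, rfl⟩, hlt⟩ := exists_lt_of_csInf_lt
    (Set.Nonempty.image g ⟨y₀, interior_subset hy₀⟩) (lt_add_of_pos_right (sInf (g '' D)) hε)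
  have hcont : ContinuousAt g y₀ :=
    hg.continuousOn_interior.continuousAt (isOpen_interior.mem_nhds hy₀)
  have hU : interior D ∩ {y | g y < g y₀ + 1} ∈ nhds y₀ :=
    Filter.inter_mem (isOpen_interior.mem_nhds hy₀)
      (hcont.eventually_lt_const (lt_add_of_pos_right _ one_pos))
  obtain ⟨t, ht, ht0, ht1⟩ : ∃ t : ℝ, (1 - t) * g x₀ + t * (g y₀ + 1) < sInf (g '' D) + ε ∧
      0 < t ∧ t < 1 := by
    have hc : Continuous fun t : ℝ => (1 - t) * g x₀ + t * (g y₀ + 1) := by fun_prop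
    have hev : ∀ᶠ t in nhdsWithin (0 : ℝ) (Set.Ioi 0),
        (1 - t) * g x₀ + t * (g y₀ + 1) < sInf (g '' D) + ε :=
      ((hc.tendsto 0).mono_left nhdsWithin_le_nhds).eventually_lt_const (by simpa using hlt)
    obtain ⟨t, h1, h2⟩ := (hev.and (Ioo_mem_nhdsGT one_pos)).exists
    exact ⟨t, h1, h2⟩
  let φ : EuclideanSpace ℝ (Fin d) → EuclideanSpace ℝ (Fin d) :=
    fun w => t⁻¹ • (w - (1 - t) • x₀)
  have hφ : Continuous φ := by fun_prop
  have hφ₀ : φ ((1 - t) • x₀ + t • y₀) = y₀ := by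
    simp only [φ, add_sub_cancel_left, smul_smul, inv_mul_cancel₀ ht0.ne', one_smul]
  refine ⟨(1 - t) • x₀ + t • y₀, mem_interior_iff_mem_nhds.mpr ?_⟩
  refine Filter.mem_of_superset (hφ.continuousAt.preimage_mem_nhds
    (by rw [hφ₀]; exact hU)) ?_
  rintro w ⟨hwD, hwg⟩
  have hw : (1 - t) • x₀ + t • φ w = w := by
    simp only [φ, smul_smul, mul_inv_cancel₀ ht0.ne', one_smul, add_sub_cancel]
  have hwD' := interior_subset hwD
  have h1t : 0 ≤ 1 - t := by linarith
  rw [← hw]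
  refine ⟨hg.1 hx₀ hwD' h1t ht0.le (by ring), ?_⟩
  have h2 := hg.2 hx₀ hwD' h1t ht0.le (by ring)
  simp only [smul_eq_mul] at h2
  have h3 := mul_le_mul_of_nonneg_left (le_of_lt (show g (φ w) < g y₀ + 1 from hwg)) ht0.le
  change _ ≤ sInf (g '' D) + ε
  linarith

/-- The basic convexity estimate along a segment that leaves the sublevel set `{g ≤ G}` at time `s`
on its way to a minimiser of `f`. -/
theorem depth_mul_le {E : Type*} [AddCommGroup E] [Module ℝ E] {D : Set E} {f g : E → ℝ}
    (hf : ConvexOn ℝ D f) (hg : ConvexOn ℝ D g) {p x : E} (hp : p ∈ D) (hx : x ∈ D) {G s : ℝ}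
    (hs : s ∈ Set.Ico (0 : ℝ) 1) (hgp : g p ≤ G)
    (hout : ∀ u ∈ Set.Ioc s 1, G < g (AffineMap.lineMap p x u)) :
    s * (G - f x) ≤
      |f (AffineMap.lineMap p x s) - g (AffineMap.lineMap p x s)| + |f p - g p| := by
  obtain ⟨hs0, hs1⟩ := hs
  set q := AffineMap.lineMap p x s with hq
  have hqD : q ∈ D := hf.1.lineMap_mem hp hx ⟨hs0, hs1.le⟩
  have hGx : G < g x := by simpa using hout 1 ⟨hs1, le_rfl⟩
  have hGq : G ≤ g q := by
    by_contra! hlt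
    have hden : 0 < g x - g q := by linarith
    -- `v` is where the chord of g from q to x reaches G. At that later point convexity gives g ≤ G,
    -- contradicting `hout`; no continuity of g at q is needed.
    set v := (G - g q) / (g x - g q) with hv
    have hv0 : 0 < v := div_pos (by linarith) hden
    have hv1 : v < 1 := (div_lt_one hden).mpr (by linarith)
    have h1 := hout (s + v * (1 - s)) ⟨by nlinarith, by nlinarith⟩
    have e : AffineMap.lineMap p x (s + v * (1 - s)) = (1 - v) • q + v • x := by
      rw [hq, AffineMap.lineMap_apply_module, AffineMap.lineMap_apply_module]
      module
    rw [e] at h1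
    have h2 := hg.2 hqD hx (by linarith : 0 ≤ 1 - v) hv0.le (by ring)
    simp only [smul_eq_mul] at h2
    have h3 : v * (g x - g q) = G - g q := div_mul_cancel₀ _ hden.ne'
    nlinarith
  have h1 := hf.2 hp hx (by linarith : 0 ≤ 1 - s) hs0 (by ring)
  rw [← AffineMap.lineMap_apply_module, ← hq] at h1
  simp only [smul_eq_mul] at h1
  have h2 := neg_abs_le (f q - g q)
  have h3 := le_abs_self (f p - g p)
  have h4 := abs_nonneg (f p - g p)
  nlinarith

/-! ### The far-point map, the exit map and the set of typical depths -/

namespace AxialFrame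

variable {n : ℕ} {x : EuclideanSpace ℝ (Fin (n + 1))} {F : AxialFrame x}
  {K : Set (EuclideanSpace ℝ (Fin (n + 1)))}

theorem volume_preimage_lower_le (hx : x ≠ 0) (hK : IsCompact K)
    {A : Set (EuclideanSpace ℝ (Fin n))} (hA : A ⊆ Prod.fst '' F.coordSet K)
    {T : Set (EuclideanSpace ℝ (Fin (n + 1)))} (hT : MeasurableSet T) :
    volume (A ∩ (fun z => F.toSpace (z, lowerHeight (F.coordSet K) z)) ⁻¹' T) ≤
      1 * (μHE[n].restrict (frontier K)) T := by
  rw [one_mul, Measure.restrict_apply hT]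
  refine volume_preimage_le_of_proj_eq (F := F) fun z hz => ⟨_, ⟨hz.2, ?_⟩, F.proj_toSpace _⟩
  exact toSpace_mem_frontier (lowerHeight_mem_frontier (isCompact_coordSet hx hK) (hA hz.1))

theorem measurable_lower (hx : x ≠ 0) (hK : IsCompact K) :
    Measurable fun z => F.toSpace (z, lowerHeight (F.coordSet K) z) :=
  F.toSpace.continuous.measurable.comp
    (measurable_id.prodMk (measurable_lowerHeight (isCompact_coordSet hx hK)))

theorem measurable_exit (hx : x ≠ 0) (hK : IsCompact K) (hconv : Convex ℝ K) :
    Measurable fun z => F.toSpace ((1 - depth (F.coordSet K) z) • z,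
      (1 - depth (F.coordSet K) z) * lowerHeight (F.coordSet K) z + depth (F.coordSet K) z) := by
  have h1 := measurable_lowerHeight (isCompact_coordSet (F := F) hx hK)
  have h2 := measurable_depth (isCompact_coordSet (F := F) hx hK) (convex_coordSet hconv)
  exact F.toSpace.continuous.measurable.comp ((((measurable_const.sub h2).smul
    measurable_id)).prodMk (((measurable_const.sub h2).mul h1).add h2))

/-- The exit point projects to z divided by Φ(z) = 1/(1 - `depth`), so the radial contraction bound
applies to the projections. -/
theorem volume_preimage_exit_le (hK : IsCompact K) (hconv : Convex ℝ K) (h0 : 0 ∈ K)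
    (hxK : x ∉ K) {A : Set (EuclideanSpace ℝ (Fin n))} (hAm : MeasurableSet A)
    (hA : A ⊆ Prod.fst '' F.coordSet K) {L : ℝ}
    (hL : ∀ z ∈ A, (1 - depth (F.coordSet K) z)⁻¹ ≤ L)
    {T : Set (EuclideanSpace ℝ (Fin (n + 1)))} (hT : MeasurableSet T) :
    volume (A ∩ (fun z => F.toSpace ((1 - depth (F.coordSet K) z) • z,
      (1 - depth (F.coordSet K) z) * lowerHeight (F.coordSet K) z +
        depth (F.coordSet K) z)) ⁻¹' T) ≤
      ENNReal.ofReal (L ^ (n + 1)) * (μHE[n].restrict (frontier K)) T := by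
  have hx : x ≠ 0 := fun h => hxK (h ▸ h0)
  have cC := isCompact_coordSet (F := F) hx hK
  have vC := convex_coordSet (F := F) hconv
  have zC := zero_mem_coordSet (F := F) h0
  have oC : ((0 : EuclideanSpace ℝ (Fin n)), (1 : ℝ)) ∉ F.coordSet K :=
    fun h => hxK (zero_one_mem_coordSet_iff.mp h)
  set γ := fun z => F.toSpace ((1 - depth (F.coordSet K) z) • z,
      (1 - depth (F.coordSet K) z) * lowerHeight (F.coordSet K) z + depth (F.coordSet K) z) with hγ
  -- The projected set need not be measurable, so its measurable hull is used.
  have hproj : F.proj '' (T ∩ frontier K) ⊆ toMeasurable volume (F.proj '' (T ∩ frontier K)) :=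
    subset_toMeasurable _ _
  have key := measure_le_of_radial_contraction volume (Φ := fun z => (1 - depth (F.coordSet K) z)⁻¹)
    (concaveOn_inv_one_sub_depth cC vC zC oC) ⟨(0, 0), zC, rfl⟩
    ((one_le_inv₀ (sub_pos.mpr (depth_lt_one cC oC))).mpr (by
      linarith [(depth_mem_Icc (C := F.coordSet K) (z := 0)).1]))
    (hAm.inter (measurable_exit hx hK hconv hT)) (Set.inter_subset_left.trans hA)
    (measurableSet_toMeasurable volume (F.proj '' (T ∩ frontier K)))
    (fun z _ => inv_pos.mpr (sub_pos.mpr (depth_lt_one cC oC))) (fun z hz => hL z hz.1)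
    (fun z hz => hproj ⟨γ z, ⟨hz.2, toSpace_mem_frontier
      (depth_mem_frontier cC vC zC oC (hA hz.1))⟩, by rw [hγ, F.proj_toSpace, inv_inv]⟩)
  rw [finrank_euclideanSpace_fin, measure_toMeasurable] at key
  refine key.trans (mul_le_mul_right ?_ _)
  rw [Measure.restrict_apply hT]
  exact volume_preimage_le_of_proj_eq (F := F) fun z hz => hz

/-- Brunn–Minkowski applied to the shadow and {`depth` ≥ 2t}, whose midpoints lie in {`depth` ≥ t},
supplies the required tail bound. -/
theorem volume_depth_comparable_mean (hK : IsCompact K) (hconv : Convex ℝ K) (h0 : 0 ∈ K)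
    (hxK : x ∉ K) (hpos : 0 < volume.real (Prod.fst '' F.coordSet K))
    (hm0 : 0 < avgDepthRatio K x) {c : ℝ} (hc : 16 * avgDepthRatio K x ≤ c) :
    volume.real (Prod.fst '' F.coordSet K) / 16 ≤
      volume.real ({z | avgDepthRatio K x / 4 ≤ depth (F.coordSet K) z ∧
        depth (F.coordSet K) z ≤ c} ∩ Prod.fst '' F.coordSet K) := by
  have hx : x ≠ 0 := fun h => hxK (h ▸ h0)
  have cC := isCompact_coordSet (F := F) hx hK
  have vC := convex_coordSet (F := F) hconv
  have zC := zero_mem_coordSet (F := F) h0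
  have oC : ((0 : EuclideanSpace ℝ (Fin n)), (1 : ℝ)) ∉ F.coordSet K :=
    fun h => hxK (zero_one_mem_coordSet_iff.mp h)
  have hψ := measurable_depth cC vC
  have hZ := measurableSet_fst_image (F := F) hx hK
  have hZtop := volume_fst_image_lt_top (F := F) hx hK
  have havg := avgDepthRatio_eq (K := K) F
  rw [setIntegral_congr_fun hZ fun z hz => depthRatio_incl hK hconv h0 hxK hz] at havg
  set Z := Prod.fst '' F.coordSet K
  have hfin : IsFiniteMeasure (volume.restrict Z) := ⟨by simpa using hZtop⟩
  have hreal : ∀ {S : Set (EuclideanSpace ℝ (Fin n))}, MeasurableSet S →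
      (volume.restrict Z).real S = volume.real (S ∩ Z) := fun hS => measureReal_restrict_apply hS
  have huniv : (volume.restrict Z).real Set.univ = volume.real Z := by
    rw [hreal MeasurableSet.univ, Set.univ_inter]
  have hge : ∀ t, MeasurableSet {z | t ≤ depth (F.coordSet K) z} := fun t =>
    measurableSet_le measurable_const hψ
  have main := measureReal_comparable_mean_ge (ν := volume.restrict Z) hψ (fun z => depth_mem_Icc)
    (fun t _ => by
      rw [hreal (hge _), hreal (hge _), huniv]
      have := volume_mul_volume_le_sq_of_midpoint_mem hZ ((hge (2 * t)).inter hZ)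
        ((hge t).inter hZ) fun y hy z hz => ⟨le_depth_midpoint cC vC zC oC hy hz.2 hz.1, by
          rw [smul_add]
          exact (concaveOn_inv_one_sub_depth cC vC zC oC).1 hy hz.2 (by norm_num) (by norm_num)
            (by norm_num)⟩
      have h2 := ENNReal.toReal_mono (ENNReal.pow_ne_top
        (measure_ne_top_of_subset Set.inter_subset_right hZtop.ne)) this
      rw [ENNReal.toReal_mul, ENNReal.toReal_pow, mul_comm] at h2
      exact h2) (huniv ▸ hpos) hm0
    (by rw [huniv, havg]; field_simp) hc
  have hmeas : MeasurableSet {z | avgDepthRatio K x / 4 ≤ depth (F.coordSet K) z ∧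
      depth (F.coordSet K) z ≤ c} := (hge _).inter (measurableSet_le hψ measurable_const)
  rwa [huniv, hreal hmeas] at main

end AxialFrame

/-! ### Nondegeneracy and excluded positions of x_⋆ -/

theorem AxialFrame.volume_real_fst_image_pos {n : ℕ} {x : EuclideanSpace ℝ (Fin (n + 1))}
    {F : AxialFrame x} {K : Set (EuclideanSpace ℝ (Fin (n + 1)))} (hx : x ≠ 0)
    (hK : IsConvexBody K) : 0 < volume.real (Prod.fst '' F.coordSet K) := by
  obtain ⟨c, hc⟩ := hK.interior_nonempty
  obtain ⟨r, hr, hball⟩ := Metric.isOpen_iff.mp isOpen_interior c hc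
  refine ENNReal.toReal_pos (ne_of_gt ?_) (AxialFrame.volume_fst_image_lt_top hx hK.isCompact).ne
  exact (Metric.measure_ball_pos volume (F.proj c) hr).trans_le
    (measure_mono (AxialFrame.ball_subset_fst_image (hball.trans interior_subset)))

theorem measureReal_shadow_pos {n : ℕ} {x : EuclideanSpace ℝ (Fin (n + 1))}
    {K : Set (EuclideanSpace ℝ (Fin (n + 1)))} (hK : IsConvexBody K) (hx : x ≠ 0) :
    0 < (μHE[n] : Measure (EuclideanSpace ℝ (Fin (n + 1)))).real (shadow x K) := by
  obtain ⟨F⟩ := nonempty_axialFrame hx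
  rw [AxialFrame.shadow_eq_image (F := F), Measure.real,
    AxialFrame.euclideanHausdorffMeasure_incl_image]
  exact AxialFrame.volume_real_fst_image_pos hx hK

theorem euclideanHausdorffMeasure_frontier_ne_zero {n : ℕ}
    {x : EuclideanSpace ℝ (Fin (n + 1))} {K : Set (EuclideanSpace ℝ (Fin (n + 1)))}
    (hK : IsConvexBody K) (hx : x ≠ 0) : μHE[n] (frontier K) ≠ 0 := by
  obtain ⟨F⟩ := nonempty_axialFrame hx
  have h : volume (Prod.fst '' F.coordSet K) ≤ μHE[n] (frontier K) :=
    AxialFrame.volume_preimage_le_of_proj_eq (F := F) fun z hz => ⟨_,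
      AxialFrame.toSpace_mem_frontier (lowerHeight_mem_frontier
        (AxialFrame.isCompact_coordSet hx hK.isCompact) hz), F.proj_toSpace _⟩
  intro h0
  rw [h0, nonpos_iff_eq_zero] at h
  have hpos := AxialFrame.volume_real_fst_image_pos (F := F) hx hK
  simp [Measure.real, h] at hpos

/-- For x = 0 the shadow is K itself, whose n-dimensional measure is infinite; its real value is
then 0 and so is the average. This excludes x_⋆ = 0. -/
theorem avgDepthRatio_zero {n : ℕ} {K : Set (EuclideanSpace ℝ (Fin (n + 1)))}
    (hK : (interior K).Nonempty) : avgDepthRatio K 0 = 0 := by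
  have hsh : shadow 0 K = K := by
    simp only [shadow, Submodule.span_zero_singleton, Submodule.bot_orthogonal_eq_top,
      Submodule.starProjection_top, ContinuousLinearMap.id_apply, Set.image_id']
  have htop : (μHE[n] : Measure (EuclideanSpace ℝ (Fin (n + 1)))) K = ⊤ := by
    refine (Measure.euclideanHausdorffMeasure_zero_or_top n.lt_succ_self K).resolve_left ?_
    rw [Nat.succ_eq_add_one, EuclideanSpace.euclideanHausdorffMeasure_eq_volume]
    exact ((isOpen_interior.measure_pos volume hK).trans_le
      (measure_mono interior_subset)).ne'
  rw [avgDepthRatio, hsh, Nat.add_sub_cancel, Measure.real, htop]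
  simp

theorem avgDepthRatio_of_mem {n : ℕ} {K : Set (EuclideanSpace ℝ (Fin (n + 1)))}
    (hK : IsConvexBody K) (h0 : 0 ∈ K) {x : EuclideanSpace ℝ (Fin (n + 1))} (hx : x ≠ 0)
    (hxK : x ∈ K) : avgDepthRatio K x = 1 := by
  obtain ⟨F⟩ := nonempty_axialFrame hx
  rw [AxialFrame.avgDepthRatio_eq F, setIntegral_congr_fun
    (AxialFrame.measurableSet_fst_image hx hK.isCompact) fun z hz =>
      AxialFrame.depthRatio_incl_of_mem hx hK.isCompact hK.convex h0 hxK hz]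
  simp only [integral_const, measureReal_restrict_apply_univ, smul_eq_mul, mul_one]
  exact inv_mul_cancel₀ (AxialFrame.volume_real_fst_image_pos hx hK).ne'

/-! ### The integrated gap estimate and the conclusion -/

/-- Bernoulli's inequality gives (1 - 1/(2d))^d ≥ 1/2, which is why depths are cut off at 1/(2d). -/
theorem inv_one_sub_pow_le_two (n : ℕ) :
    ((1 - 1 / (2 * ((n + 1 : ℕ) : ℝ)))⁻¹) ^ (n + 1) ≤ 2 := by
  have hd : (1 : ℝ) ≤ ((n + 1 : ℕ) : ℝ) := by simp
  have hc : 1 / (2 * ((n + 1 : ℕ) : ℝ)) ≤ 1 / 2 := by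
    apply one_div_le_one_div_of_le <;> linarith
  have h := one_add_mul_le_pow (a := -(1 / (2 * ((n + 1 : ℕ) : ℝ)))) (by linarith) (n + 1)
  rw [← sub_eq_add_neg, show 1 + ((n + 1 : ℕ) : ℝ) * -(1 / (2 * ((n + 1 : ℕ) : ℝ))) = 2⁻¹ by
    field_simp; ring] at h
  rw [inv_pow]
  exact inv_le_of_inv_le₀ two_pos h

theorem lintegral_frontier_eq {n : ℕ} {K : Set (EuclideanSpace ℝ (Fin (n + 1)))}
    (h0 : μHE[n] (frontier K) ≠ 0) (htop : μHE[n] (frontier K) ≠ ⊤)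
    (H : EuclideanSpace ℝ (Fin (n + 1)) → ENNReal) :
    ∫⁻ y in frontier K, H y ∂μHE[n] = μHE[n] (frontier K) * ∫⁻ y, H y ∂(surfaceProb K) := by
  rw [surfaceProb, Nat.add_sub_cancel, lintegral_smul_measure, smul_eq_mul, ← mul_assoc,
    ENNReal.mul_inv_cancel h0 htop, one_mul]

/-- The squared gap between the level `G` and the minimum of `f`, in terms of the mean square of
`f - g` over the boundary. -/
theorem gap_sq_mul_le {n : ℕ} {D K : Set (EuclideanSpace ℝ (Fin (n + 1)))}
    {f g : EuclideanSpace ℝ (Fin (n + 1)) → ℝ} (hf : ConvexOn ℝ D f) (hg : ConvexOn ℝ D g)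
    (hK : IsConvexBody K) {G : ℝ} (hKG : ∀ y, y ∈ K ↔ y ∈ D ∧ g y ≤ G) (h0 : 0 ∈ K)
    (hint : Integrable (fun y => (f y - g y) ^ 2) (surfaceProb K))
    {x : EuclideanSpace ℝ (Fin (n + 1))} (hxD : x ∈ D) (hxK : x ∉ K) (hgap : 0 ≤ G - f x)
    (hm0 : 0 < avgDepthRatio K x)
    (hm1 : avgDepthRatio K x ≤ 1 / (32 * ((n + 1 : ℕ) : ℝ))) :
    (avgDepthRatio K x / 4 * (G - f x)) ^ 2 *
        ((μHE[n] : Measure (EuclideanSpace ℝ (Fin (n + 1)))).real (shadow x K) / 16) ≤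
      6 * ((μHE[n] : Measure (EuclideanSpace ℝ (Fin (n + 1)))).real (frontier K) *
        ∫ y, (f y - g y) ^ 2 ∂(surfaceProb K)) := by
  have hx : x ≠ 0 := fun h => hxK (h ▸ h0)
  obtain ⟨F⟩ := nonempty_axialFrame hx
  have cK := hK.isCompact
  have vK := hK.convex
  have cC := AxialFrame.isCompact_coordSet (F := F) hx cK
  have vC := AxialFrame.convex_coordSet (F := F) vK
  have zC := AxialFrame.zero_mem_coordSet (F := F) h0
  have oC : ((0 : EuclideanSpace ℝ (Fin n)), (1 : ℝ)) ∉ F.coordSet K :=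
    fun h => hxK (AxialFrame.zero_one_mem_coordSet_iff.mp h)
  have hψ := measurable_depth cC vC
  have hZ := AxialFrame.measurableSet_fst_image (F := F) hx cK
  have hpos := AxialFrame.volume_real_fst_image_pos (F := F) hx hK
  have hStop := (euclideanHausdorffMeasure_frontier_lt_top hK).ne
  have hshadow : (μHE[n] : Measure (EuclideanSpace ℝ (Fin (n + 1)))).real (shadow x K) =
      volume.real (Prod.fst '' F.coordSet K) := by
    rw [AxialFrame.shadow_eq_image (F := F), Measure.real,
      AxialFrame.euclideanHausdorffMeasure_incl_image, Measure.real]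
  have hS0 := euclideanHausdorffMeasure_frontier_ne_zero hK hx
  obtain ⟨H, hHm, hHle, hHint⟩ := exists_measurable_ge_lintegral_eq
    (φ := fun y => ENNReal.ofReal ((f y - g y) ^ 2)) hint.aemeasurable.ennreal_ofReal
  -- The cutoff is 16 times the assumed upper bound 1/(32d) on the mean, as the tail lemma demands.
  set c : ℝ := 1 / (2 * ((n + 1 : ℕ) : ℝ)) with hc
  have hc16 : 16 * avgDepthRatio K x ≤ c := by
    have : c = 16 * (1 / (32 * ((n + 1 : ℕ) : ℝ))) := by rw [hc]; field_simp; norm_num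
    rw [this]
    linarith
  have hc1 : c < 1 := by
    rw [hc, div_lt_one (by positivity)]
    have : (1 : ℝ) ≤ ((n + 1 : ℕ) : ℝ) := by simp
    linarith
  have hvol := AxialFrame.volume_depth_comparable_mean (F := F) cK vK h0 hxK hpos hm0 hc16
  set m := avgDepthRatio K x
  set A := {z | m / 4 ≤ depth (F.coordSet K) z ∧ depth (F.coordSet K) z ≤ c} ∩
    Prod.fst '' F.coordSet K
  have hAm : MeasurableSet A := (((measurableSet_le measurable_const hψ).inter
    (measurableSet_le hψ measurable_const))).inter hZ
  have hAZ : A ⊆ Prod.fst '' F.coordSet K := Set.inter_subset_right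
  set lo := fun z => F.toSpace (z, lowerHeight (F.coordSet K) z) with hlo
  set ex := fun z => F.toSpace ((1 - depth (F.coordSet K) z) • z,
      (1 - depth (F.coordSet K) z) * lowerHeight (F.coordSet K) z + depth (F.coordSet K) z)
  have hlo_m : Measurable lo := AxialFrame.measurable_lower hx cK
  have hex_m : Measurable ex := AxialFrame.measurable_exit hx cK vK
  have hpt : ∀ z ∈ A, ENNReal.ofReal ((m / 4 * (G - f x)) ^ 2) ≤ 2 * H (ex z) + 2 * H (lo z) := by
    intro z hz
    have hzZ := hAZ hz
    have hloK : lo z ∈ K := (lowerHeight_isLeast cC hzZ).1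
    have hout : ∀ u ∈ Set.Ioc (depth (F.coordSet K) z) 1,
        G < g (AffineMap.lineMap (lo z) x u) := by
      intro u hu
      have hu01 : u ∈ Set.Icc (0 : ℝ) 1 := ⟨depth_mem_Icc.1.trans hu.1.le, hu.2⟩
      have hmem := mem_iff_le_depth cC vC zC hzZ hu01
      by_contra! hle
      have : AffineMap.lineMap (lo z) x u ∈ K :=
        (hKG _).mpr ⟨hf.1.lineMap_mem ((hKG _).mp hloK).1 hxD hu01, hle⟩
      rw [hlo, ← AxialFrame.toSpace_lineMap] at this
      exact absurd (hmem.mp this) (not_le.mpr hu.1)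
    have hb := depth_mul_le hf hg ((hKG _).mp hloK).1 hxD
      ⟨depth_mem_Icc.1, depth_lt_one cC oC⟩ ((hKG _).mp hloK).2 hout
    have hexz : AffineMap.lineMap (lo z) x (depth (F.coordSet K) z) = ex z :=
      (AxialFrame.toSpace_lineMap _ _ _).symm
    rw [hexz] at hb
    have h1 : m / 4 * (G - f x) ≤ |f (ex z) - g (ex z)| + |f (lo z) - g (lo z)| :=
      (mul_le_mul_of_nonneg_right hz.1.1 hgap).trans hb
    have h2 : (m / 4 * (G - f x)) ^ 2 ≤
        2 * (f (ex z) - g (ex z)) ^ 2 + 2 * (f (lo z) - g (lo z)) ^ 2 := by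
      have h3 : 0 ≤ m / 4 * (G - f x) := by positivity
      rw [← sq_abs (f (ex z) - g (ex z)), ← sq_abs (f (lo z) - g (lo z))]
      nlinarith [sq_nonneg (|f (ex z) - g (ex z)| - |f (lo z) - g (lo z)|)]
    calc _ ≤ ENNReal.ofReal (2 * (f (ex z) - g (ex z)) ^ 2 + 2 * (f (lo z) - g (lo z)) ^ 2) :=
          ENNReal.ofReal_le_ofReal h2
      _ = 2 * ENNReal.ofReal ((f (ex z) - g (ex z)) ^ 2) +
          2 * ENNReal.ofReal ((f (lo z) - g (lo z)) ^ 2) := by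
          rw [ENNReal.ofReal_add (by positivity) (by positivity), ENNReal.ofReal_mul two_pos.le,
            ENNReal.ofReal_mul two_pos.le, ENNReal.ofReal_ofNat]
      _ ≤ _ := add_le_add (mul_le_mul_right (hHle _) _) (mul_le_mul_right (hHle _) _)
  have hI1 : ∫⁻ z in A, H (lo z) ≤ 1 * ∫⁻ y in frontier K, H y ∂μHE[n] :=
    setLIntegral_comp_le hlo_m (fun T hT =>
      AxialFrame.volume_preimage_lower_le hx cK hAZ hT) hHm
  have hI2 : ∫⁻ z in A, H (ex z) ≤
      ENNReal.ofReal (((1 - c)⁻¹) ^ (n + 1)) * ∫⁻ y in frontier K, H y ∂μHE[n] :=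
    setLIntegral_comp_le hex_m (fun T hT =>
      AxialFrame.volume_preimage_exit_le cK vK h0 hxK hAm hAZ (fun z hz =>
        inv_anti₀ (sub_pos.mpr hc1) (sub_le_sub_left hz.1.2 1)) hT) hHm
  have hI2' : ∫⁻ z in A, H (ex z) ≤ 2 * ∫⁻ y in frontier K, H y ∂μHE[n] :=
    hI2.trans (mul_le_mul_left ((ENNReal.ofReal_le_ofReal (inv_one_sub_pow_le_two n)).trans_eq
      (by simp)) _)
  have hmain : ENNReal.ofReal ((m / 4 * (G - f x)) ^ 2) * volume A ≤
      6 * (μHE[n] (frontier K) * ENNReal.ofReal (∫ y, (f y - g y) ^ 2 ∂(surfaceProb K))) := by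
    rw [ofReal_integral_eq_lintegral_ofReal hint
      (Filter.Eventually.of_forall fun y => sq_nonneg _), ← hHint, ← lintegral_frontier_eq hS0 hStop]
    calc ENNReal.ofReal ((m / 4 * (G - f x)) ^ 2) * volume A
        = ∫⁻ _ in A, ENNReal.ofReal ((m / 4 * (G - f x)) ^ 2) := by rw [setLIntegral_const]
      _ ≤ ∫⁻ z in A, (2 * H (ex z) + 2 * H (lo z)) := setLIntegral_mono' hAm hpt
      _ = 2 * (∫⁻ z in A, H (ex z)) + 2 * ∫⁻ z in A, H (lo z) := by
          have hHex : Measurable fun z => H (ex z) := hHm.comp hex_m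
          have hHlo : Measurable fun z => H (lo z) := hHm.comp hlo_m
          rw [lintegral_add_left (hHex.const_mul 2), lintegral_const_mul 2 hHex,
            lintegral_const_mul 2 hHlo]
      -- The exit map costs a factor 2 and the far-point map a factor 1; with the factor 2 from
      -- squaring the sum this gives 6.
      _ ≤ 2 * (2 * ∫⁻ y in frontier K, H y ∂μHE[n]) + 2 * (1 * ∫⁻ y in frontier K, H y ∂μHE[n]) :=
          add_le_add (mul_le_mul_right hI2' _) (mul_le_mul_right hI1 _)
      _ = _ := by ring
  have hI0 : 0 ≤ ∫ y, (f y - g y) ^ 2 ∂(surfaceProb K) := integral_nonneg fun y => sq_nonneg _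
  have hreal := ENNReal.toReal_mono (ENNReal.mul_ne_top (by norm_num)
    (ENNReal.mul_ne_top hStop ENNReal.ofReal_ne_top)) hmain
  rw [ENNReal.toReal_mul, ENNReal.toReal_mul, ENNReal.toReal_mul,
    ENNReal.toReal_ofReal (sq_nonneg _), ENNReal.toReal_ofReal hI0, ENNReal.toReal_ofNat] at hreal
  rw [hshadow]
  exact (mul_le_mul_of_nonneg_left hvol (sq_nonneg _)).trans hreal

end ConvexBandit

theorem mainTheorem3 {d : ℕ} (hd : 1 ≤ d)
    (D : Set (EuclideanSpace ℝ (Fin d))) (hD : ConvexBandit.IsConvexBody D)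
    (f g : EuclideanSpace ℝ (Fin d) → ℝ) (hf : ConvexOn ℝ D f) (hg : ConvexOn ℝ D g)
    (hfg : ConvexBandit.infOn D f ≤ ConvexBandit.infOn D g)
    (ε : ℝ) (hε : 0 < ε)
    (K : Set (EuclideanSpace ℝ (Fin d))) (hK : K = ConvexBandit.levelSet D g ε)
    (hKclosed : IsClosed K)
    (hgint : Integrable g (ConvexBandit.surfaceProb K))
    (hfgint : Integrable (fun x => (f x - g x) ^ 2) (ConvexBandit.surfaceProb K))
    (xs : EuclideanSpace ℝ (Fin d)) (hxs : xs ∈ D) (hmin : IsMinOn f D xs)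
    (h0 : (0 : EuclideanSpace ℝ (Fin d)) ∈ K)
    (hΨ : ConvexBandit.avgDepthRatio K xs ∈
      Set.Icc (1 / (128 * (d : ℝ))) (1 / (32 * (d : ℝ)))) :
    (∫ x, g x ∂(ConvexBandit.surfaceProb K)) - ConvexBandit.infOn D f ≤
      2 ^ 13 * (d : ℝ) *
        √(ConvexBandit.maxSurfaceShadowRatio K *
          (∫ x, (f x - g x) ^ 2 ∂(ConvexBandit.surfaceProb K))) := by
  obtain ⟨n, rfl⟩ : ∃ n, d = n + 1 := ⟨d - 1, by omega⟩
  have hKb : ConvexBandit.IsConvexBody K := by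
    rw [hK] at hKclosed ⊢
    exact ConvexBandit.isConvexBody_levelSet hD hg hε hKclosed
  set G := ConvexBandit.infOn D g + ε with hG
  have hKG : ∀ y, y ∈ K ↔ y ∈ D ∧ g y ≤ G := fun y => by rw [hK]; rfl
  have hd0 : (1 : ℝ) ≤ ((n + 1 : ℕ) : ℝ) := by simp
  obtain ⟨hΨ1, hΨ2⟩ := hΨ
  have hm0 : 0 < ConvexBandit.avgDepthRatio K xs := lt_of_lt_of_le (by positivity) hΨ1
  have hx : xs ≠ 0 := by
    rintro rfl
    rw [ConvexBandit.avgDepthRatio_zero hKb.interior_nonempty] at hm0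
    exact lt_irrefl _ hm0
  have hxK : xs ∉ K := by
    intro h
    rw [ConvexBandit.avgDepthRatio_of_mem hKb h0 hx h, le_div_iff₀ (by positivity)] at hΨ2
    linarith
  have hfinf : ConvexBandit.infOn D f = f xs :=
    IsLeast.csInf_eq ⟨⟨xs, hxs, rfl⟩, by rintro _ ⟨y, hy, rfl⟩; exact hmin hy⟩
  have hStop := (ConvexBandit.euclideanHausdorffMeasure_frontier_lt_top hKb).ne
  have hN : 0 < (μHE[n] : Measure (EuclideanSpace ℝ (Fin (n + 1)))).real
      (ConvexBandit.shadow xs K) := ConvexBandit.measureReal_shadow_pos hKb hx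
  have hS0 : μHE[n] (frontier K) ≠ 0 := ConvexBandit.euclideanHausdorffMeasure_frontier_ne_zero hKb hx
  have hprob : IsProbabilityMeasure (ConvexBandit.surfaceProb K) :=
    ⟨by simp [ConvexBandit.surfaceProb, ENNReal.inv_mul_cancel hS0 hStop]⟩
  have hle : ∫ x, g x ∂(ConvexBandit.surfaceProb K) ≤ G := by
    have hae : ∀ᵐ y ∂(ConvexBandit.surfaceProb K), g y ≤ G := by
      refine Measure.ae_smul_measure ?_ _
      refine (ae_restrict_iff' isClosed_frontier.measurableSet).mpr
        (Filter.Eventually.of_forall fun y hy => ?_)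
      exact ((hKG y).mp (hKclosed.frontier_subset hy)).2
    calc _ ≤ ∫ _, G ∂(ConvexBandit.surfaceProb K) :=
          integral_mono_ae hgint (integrable_const _) hae
      _ = G := by simp
  rw [hfinf]
  refine (sub_le_sub_right hle _).trans ?_
  rcases le_or_gt (G - f xs) 0 with hneg | hgap
  -- With no positive gap the bound is trivial, its right side being nonnegative.
  · exact hneg.trans (by positivity)
  have key := ConvexBandit.gap_sq_mul_le hf hg hKb hKG h0 hfgint hxs hxK hgap.le hm0 hΨ2
  have hR := ConvexBandit.ratio_le_maxSurfaceShadowRatio hKb hx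
  have hI0 : 0 ≤ ∫ y, (f y - g y) ^ 2 ∂(ConvexBandit.surfaceProb K) :=
    integral_nonneg fun y => sq_nonneg _
  have hRI := mul_le_mul_of_nonneg_right hR hI0
  generalize (∫ y, (f y - g y) ^ 2 ∂(ConvexBandit.surfaceProb K)) = I at *
  generalize ConvexBandit.maxSurfaceShadowRatio K = R at *
  generalize ConvexBandit.avgDepthRatio K xs = m at *
  generalize (μHE[n] : Measure (EuclideanSpace ℝ (Fin (n + 1)))).real
    (ConvexBandit.shadow xs K) = N at *
  generalize (μHE[n] : Measure (EuclideanSpace ℝ (Fin (n + 1)))).real (frontier K) = S at *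
  generalize G - f xs = Δ at *
  generalize ((n + 1 : ℕ) : ℝ) = d at *
  have hd1 : 0 < d := by linarith
  -- 1536 = 6 · 16 · 4²: the 16 is the share of the shadow, the 4² comes from m/4.
  have hSI : (m * Δ) ^ 2 ≤ 1536 * (S / N * I) := by
    have e : S / N * I = (S * I) / N := by ring
    rw [e, mul_div_assoc', le_div_iff₀ hN]
    nlinarith
  have hmd : 1 ≤ 128 * d * m := by
    rw [div_le_iff₀ (by positivity)] at hΨ1
    linarith
  have hΔ : Δ ≤ 128 * d * (m * Δ) := by nlinarith
  have hsq : Δ ^ 2 ≤ (2 ^ 13 * d) ^ 2 * (R * I) := by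
    calc Δ ^ 2 ≤ (128 * d * (m * Δ)) ^ 2 := by gcongr
      _ = (128 * d) ^ 2 * (m * Δ) ^ 2 := by ring
      _ ≤ (128 * d) ^ 2 * (1536 * (R * I)) := by
          gcongr
          exact hSI.trans (by linarith)
      -- Here 1536 ≤ 64² and 128 · 64 = 2^13.
      _ ≤ (2 ^ 13 * d) ^ 2 * (R * I) := by
          have : 0 ≤ d ^ 2 * (R * I) := by
            have : 0 ≤ R * I := by nlinarith [sq_nonneg (m * Δ)]
            positivity
          nlinarith
  calc Δ ≤ √((2 ^ 13 * d) ^ 2 * (R * I)) := Real.le_sqrt_of_sq_le hsq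
    _ = _ := by rw [Real.sqrt_mul (by positivity), Real.sqrt_sq (by positivity)]
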